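/- Let $I=(0,1)$, $e_3=(0,0,1)$, and let $a\in\mathbb{R}^3$ be a fixed vector with $|a|=1$. For $m\ge 0$ let $H^m(I)$ be the Sobolev space of functions whose weak derivatives up to order $m$ belong to $L^2(I)$, with its usual norm; an $\mathbb{R}^3$-valued function belongs to $H^m(I)$ if each of its components does. Consider the initial-boundary value problem $$v_t = v\times v_{ss}\ \ (s\in I,\ t>0),\qquad v(s,0)=v_0(s),\qquad v(0,t)=a,\quad v(1,t)=e_3 .$$ Put $P_0(v)=v$ and, for $m\ge1$, $$P_m(v)=\sum_{j=0}^{m-1}\binom{m-1}{j}\,P_j(v)\times\partial_s^2P_{m-1-j}(v).$$ A function $v_0$ satisfies the compatibility condition of order $m$ if $v_0\in H^{2m+1}(I)$ and, in the sense of traces, $v_0(0)=a$ and $v_0(1)=e_3$ when $m=0$, respectively $P_m(v_0)|_{s=0}=P_m(v_0)|_{s=1}=0$ when $m\ge1$. It satisfies the compatibility conditions up to order $m$ if it satisfies the compatibility condition of order $k$ for every $0\le k\le m$. **Proposition.** Let $l$ and $N$ be non-negative integers. Let $v_0\in H^{l+3}(I)$ be $\mathbb{R}^3$-valued with $|v_0|\equiv1$,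 and let $v_0$ satisfy the compatibility conditions up to order $\left[\frac{l+3}{2}\right]$, where $[x]$ is the largest integer not exceeding $x$. Then there is a sequence $(v_0^n)_{n\ge1}$ such that, for every $n$, $|v_0^n|\equiv1$, $v_0^n\in H^{l+3+N}(I)$, and $v_0^n$ satisfies the compatibility conditions up to order $\left[\frac{l+3+N}{2}\right]$, and such that $v_0^n\to v_0$ in $H^{l+3}(I)$ as $n\to\infty$. -/

import Mathlib

open MeasureTheory Filter
open scoped ContDiff Topology ENNReal Matrix

namespace VortexFilament

/-- The open interval `I = (0,1)`. -/
abbrev I : Set ℝ := Set.Ioo 0 1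

/-- Test functions on `I`: the elements of `C_c^∞(I)`. -/
structure IsTestFunction (φ : ℝ → ℝ) : Prop where
  smooth : ContDiff ℝ ∞ φ
  compact : HasCompactSupport φ
  support : tsupport φ ⊆ I

/-- `w` is the `j`-th weak (distributional) derivative of `u` on `I`. Functions on `I` are given as
functions on `ℝ`, of which only the restriction to `I`, up to null sets, matters. -/
structure IsWeakDeriv (j : ℕ) (u w : ℝ → ℝ) : Prop where
  locInt : LocallyIntegrableOn u I
  locInt_deriv : LocallyIntegrableOn w I
  integral_eq : ∀ φ : ℝ → ℝ, IsTestFunction φ →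
    ∫ s in I, u s * iteratedDeriv j φ s = (-1) ^ j * ∫ s in I, w s * φ s

open Classical in
/-- The `j`-th weak derivative of `u` on `I` (unique up to null sets), if there is one;
the zero function otherwise. -/
noncomputable def weakDeriv (j : ℕ) (u : ℝ → ℝ) : ℝ → ℝ :=
  if h : ∃ w, IsWeakDeriv j u w then h.choose else 0

/-- The Sobolev space `H^m(I) = W^{m,2}(I)` of real-valued functions. -/
def MemH (m : ℕ) (u : ℝ → ℝ) : Prop :=
  ∀ j ≤ m, ∃ w, IsWeakDeriv j u w ∧ MemLp w 2 (volume.restrict I)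

/-- The Sobolev space `H^m(I)` of `ℝ³`-valued functions: each component belongs to `H^m(I)`. -/
def MemHVec (m : ℕ) (v : ℝ → Fin 3 → ℝ) : Prop :=
  ∀ i, MemH m (fun s => v s i)

/-- The norm of `H^m(I)` for `ℝ³`-valued functions,
`(∑ᵢ ∑_{j ≤ m} ‖∂ʲ vᵢ‖²)^{1/2}` with the norm of `L²(I)` on the right. -/
noncomputable def normH (m : ℕ) (v : ℝ → Fin 3 → ℝ) : ℝ≥0∞ :=
  (∑ i, ∑ j ∈ Finset.range (m + 1),
    eLpNorm (weakDeriv j (fun s => v s i)) 2 (volume.restrict I) ^ 2) ^ (1 / 2 : ℝ)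

/-- The second weak derivative of an `ℝ³`-valued function, componentwise. -/
noncomputable def weakDeriv2 (v : ℝ → Fin 3 → ℝ) : ℝ → Fin 3 → ℝ :=
  fun s i => weakDeriv 2 (fun t => v t i) s

/-- The expressions `P_m(v)` for `∂ₜᵐ v` under `vₜ = v × vₛₛ`: `P_0(v) = v` and
`P_{m+1}(v) = ∑_{j=0}^{m} (m choose j) P_j(v) × ∂ₛ² P_{m-j}(v)`. -/
noncomputable def P (v : ℝ → Fin 3 → ℝ) : ℕ → ℝ → Fin 3 → ℝ
  | 0 => v
  | m + 1 => fun s => ∑ j : Fin (m + 1),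
      (m.choose j : ℝ) • (P v j s ⨯₃ weakDeriv2 (P v (m - j)) s)
  termination_by m => m
  decreasing_by all_goals omega

/-- The trace of `u` at the point `s₀ ∈ [0,1]` exists and equals `c`: the class of `u` has a
representative continuous on `[0,1]` (necessarily unique there), with the value `c` at `s₀`. -/
def HasTrace (u : ℝ → Fin 3 → ℝ) (s₀ : ℝ) (c : Fin 3 → ℝ) : Prop :=
  ∃ g : ℝ → Fin 3 → ℝ, ContinuousOn g (Set.Icc 0 1) ∧ u =ᵐ[volume.restrict I] g ∧ g s₀ = c

/-- The vector `e₃ = (0,0,1)`. -/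
def e₃ : Fin 3 → ℝ := ![0, 0, 1]

/-- The `m`-th order compatibility condition for the problem `vₜ = v × vₛₛ` on `I`,
`v(0,t) = a`, `v(1,t) = e₃`, with initial datum `v`. -/
def Compat (a : Fin 3 → ℝ) (m : ℕ) (v : ℝ → Fin 3 → ℝ) : Prop :=
  MemHVec (2 * m + 1) v ∧
    (m = 0 → HasTrace v 0 a ∧ HasTrace v 1 e₃) ∧
    (1 ≤ m → HasTrace (P v m) 0 0 ∧ HasTrace (P v m) 1 0)

/-- The compatibility conditions up to order `m`. -/
def CompatUpTo (a : Fin 3 → ℝ) (m : ℕ) (v : ℝ → Fin 3 → ℝ) : Prop :=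
  ∀ k ≤ m, Compat a k v

/-- `|v| ≡ 1` on `I`, with the Euclidean norm of `ℝ³` (for an a.e. class). -/
def UnitLength (v : ℝ → Fin 3 → ℝ) : Prop :=
  ∀ᵐ s ∂(volume.restrict I), ‖WithLp.toLp 2 (v s)‖ = 1

end VortexFilament

/-!
# Approximation of compatible initial data for the vortex filament equation

The key is that the compatibility conditions at an endpoint `p` with boundary value `b` are a
symmetry condition. Let `R` be the rotation by `π` about the axis `b` (`halfTurn`), and reflect a
curve `v` to `s ↦ R (v (2p - s))` (`reflect`). Rotations preserve the cross product and `P_m`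
contains an even number of derivatives in each term, so `P_m` commutes with reflection
(`classicalP_reflect`).

* If `v` is smooth and equal to its reflection near `p`, then the vectors `P_m(v)(p)` and
  `∂² P_m(v)(p)` lie on the axis, and `P_{m+1}(v)(p)`, a sum of their cross products, vanishes
  (`classicalP_eq_zero_of_symmetric`).
* Conversely, let `|v| = 1`, `v(p) = b` and `P_m(v)(p) = 0` for `1 ≤ m ≤ K`. Then the derivatives of
  `v` at `p` up to the order `2K` agree with those of its reflection (`iteratedDeriv_eq_halfTurn`),
  by induction on the order. Let `c` be the difference of the derivatives of order `N`. If `N` is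
  odd, `c` is parallel to `b`, and differentiating `|v|² = 1` shows that `c = 0`. If `N = 2k`, `c`
  is orthogonal to `b`; the leading term of `P_k(v)` is `(v ×)^k ∂^{2k} v`
  (`leadingJet_classicalP`), so `(b ×)^k c = 0`, whence `c = 0`.

With `K = ⌊(l+3)/2⌋` the hypotheses give `v₀ ∈ H^{2K+1}(I)`, and `2K + 1 ≥ l + 3`. Approximate the
derivative of order `2K + 1` in `L²(I)` by smooth functions vanishing near the endpoints, and
integrate `2K + 1` times, correcting the value at `1` at each step by a multiple of a cutoff
function. This gives smooth `w n → v₀` in `H^{2K+1}(I)` which near each endpoint equal the Taylor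
polynomial of `v₀`, and so are exactly symmetric there (`exists_symmetric_sobolevTendsto`). The
symmetry survives the normalisation `w n / |w n|`, which therefore satisfies the compatibility
conditions of every order; it converges to `v₀` because `H^{2K+1}(I)` is stable under products and
composition with smooth functions (`SobolevTendsto.bilinear`, `SobolevTendsto.comp`).
-/

namespace VortexFilament

/-! ### Convergence in Sobolev spaces on the interval -/

section SobolevConvergence

variable {E : Type*} [NormedAddCommGroup E]

instance : IsProbabilityMeasure (volume.restrict I) := ⟨by simp⟩

lemma memLp_of_continuousOn {g : ℝ → E} (hg : ContinuousOn g (Set.Icc 0 1)) (p : ℝ≥0∞) :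
    MemLp g p (volume.restrict I) := by
  obtain ⟨C, hC⟩ := isCompact_Icc.exists_bound_of_continuousOn hg
  refine MemLp.of_bound ((hg.mono Set.Ioo_subset_Icc_self).aestronglyMeasurable measurableSet_Ioo)
    C ?_
  filter_upwards [ae_restrict_mem measurableSet_Ioo] with s hs
  exact hC s (Set.Ioo_subset_Icc_self hs)

lemma intervalIntegrable_of_memLp {f : ℝ → E} (hf : MemLp f 2 (volume.restrict I)) {s : ℝ}
    (hs : s ∈ Set.Icc (0 : ℝ) 1) : IntervalIntegrable f volume 0 s := by
  have h1 : IntegrableOn f (Set.Ioc 0 1) :=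
    (integrableOn_Ioc_iff_integrableOn_Ioo).2 (hf.integrable one_le_two)
  rw [intervalIntegrable_iff_integrableOn_Ioc_of_le hs.1]
  exact h1.mono_set (Set.Ioc_subset_Ioc_right hs.2)

lemma tendsto_eLpNorm_of_tendstoUniformlyOn {u : ℕ → ℝ → E} {g : ℝ → E}
    (H : TendstoUniformlyOn u g atTop (Set.Icc 0 1)) :
    Tendsto (fun n => eLpNorm (u n - g) 2 (volume.restrict I)) atTop (𝓝 0) := by
  rw [ENNReal.tendsto_nhds_zero]
  intro ε hε
  obtain ⟨δ, hδ, hδε⟩ : ∃ δ : ℝ, 0 < δ ∧ ENNReal.ofReal δ ≤ ε := by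
    rcases eq_or_ne ε ∞ with rfl | h
    · exact ⟨1, one_pos, le_top⟩
    · exact ⟨ε.toReal, ENNReal.toReal_pos hε.ne' h, ENNReal.ofReal_toReal_le⟩
  filter_upwards [Metric.tendstoUniformlyOn_iff.1 H δ hδ] with n hn
  refine le_trans ?_ hδε
  have := eLpNorm_le_of_ae_bound (p := 2) (μ := volume.restrict I) (f := u n - g) (C := δ) ?_
  · simpa using this
  · filter_upwards [ae_restrict_mem measurableSet_Ioo] with s hs
    have := hn s (Set.Ioo_subset_Icc_self hs)
    rw [dist_comm, dist_eq_norm] at this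
    exact this.le

variable {F G : Type*} [NormedSpace ℝ E] [NormedAddCommGroup F] [NormedSpace ℝ F]
  [NormedAddCommGroup G] [NormedSpace ℝ G]

/-- Convergence in `H^m(I)` of smooth functions `u n` to `g`, by recursion on `m`: convergence in
`L²(I)` for `m = 0`; for `m + 1`, convergence at the point `0` together with convergence of the
derivatives in `H^m(I)` to some `h` of which `g` is a primitive on `[0,1]`. For `m ≥ 1` this fixes
the values of `g` on all of `[0,1]`, that is, `g` is the continuous representative. Smoothness of
`u n` is not part of the definition. -/
def SobolevTendsto : ℕ → (ℕ → ℝ → E) → (ℝ → E) → Prop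
  | 0, u, g => MemLp g 2 (volume.restrict I) ∧
      Tendsto (fun n => eLpNorm (u n - g) 2 (volume.restrict I)) atTop (𝓝 0)
  | m + 1, u, g => Tendsto (fun n => u n 0) atTop (𝓝 (g 0)) ∧
      ∃ h, SobolevTendsto m (fun n => deriv (u n)) h ∧
        ∀ s ∈ Set.Icc (0 : ℝ) 1, g s = g 0 + ∫ t in (0 : ℝ)..s, h t

lemma hasDerivAt_primitive [CompleteSpace E] {h : ℝ → E} (hh : Continuous h) (s : ℝ) :
    HasDerivAt (fun s => ∫ t in (0 : ℝ)..s, h t) (h s) s :=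
  intervalIntegral.integral_hasDerivAt_right (hh.intervalIntegrable _ _)
    (hh.stronglyMeasurableAtFilter _ _) hh.continuousAt

lemma deriv_primitive [CompleteSpace E] {h : ℝ → E} (hh : Continuous h) :
    deriv (fun s => ∫ t in (0 : ℝ)..s, h t) = h :=
  funext fun s => (hasDerivAt_primitive hh s).deriv

lemma contDiff_primitive [CompleteSpace E] {h : ℝ → E} (hh : ContDiff ℝ ∞ h) :
    ContDiff ℝ ∞ (fun s => ∫ t in (0 : ℝ)..s, h t) :=
  contDiff_infty_iff_deriv.2 ⟨fun s => (hasDerivAt_primitive hh.continuous s).differentiableAt,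
    by rwa [deriv_primitive hh.continuous]⟩

/-- Since `I` has measure one, the `L²(I)` norm controls the integrals over all `[0, s]`, `s ≤ 1`.
-/
lemma norm_integral_le_eLpNorm {f : ℝ → E} (hf : MemLp f 2 (volume.restrict I)) {s : ℝ}
    (hs : s ∈ Set.Icc (0 : ℝ) 1) :
    ‖∫ t in (0 : ℝ)..s, f t‖ ≤ (eLpNorm f 2 (volume.restrict I)).toReal := by
  have h1 : IntegrableOn f (Set.Ioc 0 1) :=
    (integrableOn_Ioc_iff_integrableOn_Ioo).2 (hf.integrable one_le_two)
  calc ‖∫ t in (0 : ℝ)..s, f t‖ ≤ ∫ t in Set.Ioc 0 s, ‖f t‖ := by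
        rw [intervalIntegral.integral_of_le hs.1]; exact norm_integral_le_integral_norm _
    _ ≤ ∫ t in Set.Ioc 0 1, ‖f t‖ :=
        setIntegral_mono_set h1.norm (ae_of_all _ fun _ => norm_nonneg _)
          (Set.Ioc_subset_Ioc_right hs.2).eventuallyLE
    _ = (eLpNorm f 1 (volume.restrict I)).toReal := by
        rw [integral_Ioc_eq_integral_Ioo, integral_norm_eq_lintegral_enorm hf.1,
          eLpNorm_one_eq_lintegral_enorm]
    _ ≤ _ := ENNReal.toReal_mono hf.2.ne (eLpNorm_le_eLpNorm_of_exponent_le one_le_two hf.1)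

lemma tendstoUniformlyOn_integral {u : ℕ → ℝ → E} {h : ℝ → E} (hu : ∀ n, Continuous (u n))
    (H : SobolevTendsto 0 u h) :
    TendstoUniformlyOn (fun n s => ∫ t in (0 : ℝ)..s, u n t) (fun s => ∫ t in (0 : ℝ)..s, h t)
      atTop (Set.Icc 0 1) := by
  obtain ⟨hm, hl⟩ := H
  rw [Metric.tendstoUniformlyOn_iff]
  intro ε hε
  filter_upwards [hl.eventually (gt_mem_nhds (ENNReal.ofReal_pos.2 hε))] with n hn s hs
  have h2 : MemLp (u n - h) 2 (volume.restrict I) :=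
    (memLp_of_continuousOn (hu n).continuousOn 2).sub hm
  rw [dist_comm, dist_eq_norm, ← intervalIntegral.integral_sub ((hu n).intervalIntegrable _ _)
    (intervalIntegrable_of_memLp hm hs)]
  refine (norm_integral_le_eLpNorm h2 hs).trans_lt ?_
  exact (ENNReal.lt_ofReal_iff_toReal_lt h2.2.ne).1 hn

lemma continuousOn_integral {h : ℝ → E} (hh : MemLp h 2 (volume.restrict I)) :
    ContinuousOn (fun s => ∫ t in (0 : ℝ)..s, h t) (Set.Icc 0 1) := by
  refine (intervalIntegral.continuousOn_primitive_interval' (b₁ := 0) (b₂ := 1) ?_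
    (by simp)).mono ?_
  · exact intervalIntegrable_of_memLp hh (by simp)
  · simp [Set.uIcc_of_le]

lemma contDiff_infty_deriv {u : ℝ → E} (hu : ContDiff ℝ ∞ u) : ContDiff ℝ ∞ (deriv u) :=
  (contDiff_infty_iff_deriv.1 hu).2

lemma contDiff_infty_hasDerivAt {u : ℝ → E} (hu : ContDiff ℝ ∞ u) (s : ℝ) :
    HasDerivAt u (deriv u s) s :=
  ((contDiff_infty_iff_deriv.1 hu).1 s).hasDerivAt

lemma eq_add_integral_deriv [CompleteSpace E] {u : ℝ → E} (hu : ContDiff ℝ ∞ u) (a s : ℝ) :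
    u s = u a + ∫ t in a..s, deriv u t := by
  rw [intervalIntegral.integral_eq_sub_of_hasDerivAt (fun t _ => contDiff_infty_hasDerivAt hu t)
    ((contDiff_infty_deriv hu).continuous.intervalIntegrable _ _)]
  abel

/-- The one-dimensional Sobolev embedding `H^{m+1}(I) → C([0,1])`, and the inclusion
`H^{m+1}(I) ⊆ H^m(I)`, for convergent sequences. -/
lemma SobolevTendsto.continuousOn_and_uniform_and_mono [CompleteSpace E] :
    ∀ {m : ℕ} {u : ℕ → ℝ → E} {g : ℝ → E},
    (∀ n, ContDiff ℝ ∞ (u n)) → SobolevTendsto (m + 1) u g →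
      ContinuousOn g (Set.Icc 0 1) ∧ TendstoUniformlyOn u g atTop (Set.Icc 0 1) ∧
        SobolevTendsto m u g := by
  intro m
  induction m with
  | zero =>
    rintro u g hu ⟨h0, h, hh, hg⟩
    have hc : ContinuousOn g (Set.Icc 0 1) :=
      (continuousOn_const.add (continuousOn_integral hh.1)).congr hg
    have hun : TendstoUniformlyOn u g atTop (Set.Icc 0 1) := by
      have h1 := (h0.tendstoUniformlyOn_const (Set.Icc (0 : ℝ) 1)).add
        (tendstoUniformlyOn_integral (fun n => (contDiff_infty_deriv (hu n)).continuous) hh)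
      refine (h1.congr_right fun s hs => (hg s hs).symm).congr
        (Eventually.of_forall fun n s _ => ?_)
      exact (eq_add_integral_deriv (hu n) 0 s).symm
    exact ⟨hc, hun, memLp_of_continuousOn hc 2, tendsto_eLpNorm_of_tendstoUniformlyOn hun⟩
  | succ m ih =>
    rintro u g hu ⟨h0, h, hh, hg⟩
    obtain ⟨h1, h2, h3⟩ := ih (fun n => contDiff_infty_deriv (hu n)) hh
    have h4 : SobolevTendsto (m + 1) u g := ⟨h0, h, h3, hg⟩
    obtain ⟨h5, h6, -⟩ := ih hu h4
    exact ⟨h5, h6, h4⟩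

/-- To show convergence in `H^{m+1}(I)`, it suffices to have pointwise convergence and convergence
of the derivatives in `H^m(I)`: the fundamental theorem of calculus passes to the limit. This
replaces the computation of weak derivatives of products and compositions. -/
lemma SobolevTendsto.of_deriv [CompleteSpace E] {m : ℕ} {u : ℕ → ℝ → E} {g h : ℝ → E}
    (hu : ∀ n, ContDiff ℝ ∞ (u n))
    (hg : ∀ s ∈ Set.Icc (0 : ℝ) 1, Tendsto (fun n => u n s) atTop (𝓝 (g s)))
    (hh : SobolevTendsto m (fun n => deriv (u n)) h) : SobolevTendsto (m + 1) u g := by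
  refine ⟨hg 0 (by simp), h, hh, fun s hs => ?_⟩
  have h0 : SobolevTendsto 0 (fun n => deriv (u n)) h := by
    clear hg
    induction m with
    | zero => exact hh
    | succ m ih =>
      exact ih (SobolevTendsto.continuousOn_and_uniform_and_mono
        (fun n => contDiff_infty_deriv (hu n)) hh).2.2
  refine tendsto_nhds_unique (hg s hs) ?_
  have := (hg 0 (by simp)).add ((tendstoUniformlyOn_integral
    (fun n => (contDiff_infty_deriv (hu n)).continuous) h0).tendsto_at hs)
  refine this.congr fun n => (eq_add_integral_deriv (hu n) 0 s).symm

lemma SobolevTendsto.add [CompleteSpace E] : ∀ {m : ℕ} {u w : ℕ → ℝ → E} {g h : ℝ → E},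
    (∀ n, ContDiff ℝ ∞ (u n)) → (∀ n, ContDiff ℝ ∞ (w n)) → SobolevTendsto m u g →
      SobolevTendsto m w h → SobolevTendsto m (fun n s => u n s + w n s) (fun s => g s + h s) := by
  intro m
  induction m with
  | zero =>
    rintro u w g h hu hw ⟨hg, hug⟩ ⟨hh, hwh⟩
    refine ⟨hg.add hh, ?_⟩
    have h1 := hug.add hwh
    rw [add_zero] at h1
    refine tendsto_of_tendsto_of_tendsto_of_le_of_le tendsto_const_nhds h1 (fun _ => zero_le)
      (fun n => ?_)
    have e : ((fun s => u n s + w n s) - fun s => g s + h s) = (u n - g) + (w n - h) := by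
      ext s; simp only [Pi.sub_apply, Pi.add_apply]; abel
    dsimp only
    rw [e]
    exact eLpNorm_add_le ((hu n).continuous.aestronglyMeasurable.sub hg.1)
      ((hw n).continuous.aestronglyMeasurable.sub hh.1) one_le_two
  | succ m ih =>
    intro u w g h hu hw hg hh
    have hg' := (SobolevTendsto.continuousOn_and_uniform_and_mono hu hg).2.1
    have hh' := (SobolevTendsto.continuousOn_and_uniform_and_mono hw hh).2.1
    obtain ⟨-, g1, hg1, -⟩ := hg
    obtain ⟨-, h1, hh1, -⟩ := hh
    refine SobolevTendsto.of_deriv (fun n => (hu n).add (hw n))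
      (fun s hs => (hg'.tendsto_at hs).add (hh'.tendsto_at hs)) (h := fun s => g1 s + h1 s) ?_
    have := ih (fun n => contDiff_infty_deriv (hu n)) (fun n => contDiff_infty_deriv (hw n)) hg1 hh1
    convert this using 3 with n s
    exact ((contDiff_infty_hasDerivAt (hu n) s).fun_add (contDiff_infty_hasDerivAt (hw n) s)).deriv

/-- The product of a uniformly convergent and an `L²(I)`-convergent sequence converges in `L²(I)`.
-/
lemma SobolevTendsto.bilinear_zero (B : E →L[ℝ] F →L[ℝ] G) {u : ℕ → ℝ → E} {g : ℝ → E}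
    {w : ℕ → ℝ → F} {h : ℝ → F}
    (hg : ContinuousOn g (Set.Icc 0 1)) (hu : ∀ n, Continuous (u n)) (hw : ∀ n, Continuous (w n))
    (H1 : TendstoUniformlyOn u g atTop (Set.Icc 0 1)) (H2 : SobolevTendsto 0 w h) :
    SobolevTendsto 0 (fun n s => B (u n s) (w n s)) (fun s => B (g s) (h s)) := by
  obtain ⟨hh, hwh⟩ := H2
  obtain ⟨C, hC⟩ := isCompact_Icc.exists_bound_of_continuousOn hg
  have hgm := (hg.mono Set.Ioo_subset_Icc_self).aestronglyMeasurable (μ := volume)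
    measurableSet_Ioo
  have hC0 : 0 ≤ C := (norm_nonneg _).trans (hC 0 (by simp))
  have key : ∀ {f : ℝ → E} {k : ℝ → F} {D : ℝ}, 0 ≤ D → (∀ s ∈ Set.Icc (0 : ℝ) 1, ‖f s‖ ≤ D) →
      eLpNorm (fun s => B (f s) (k s)) 2 (volume.restrict I) ≤
        ENNReal.ofReal (‖B‖ * D) * eLpNorm k 2 (volume.restrict I) := by
    intro f k D hD hf
    refine eLpNorm_le_mul_eLpNorm_of_ae_le_mul ?_ 2
    filter_upwards [ae_restrict_mem measurableSet_Ioo] with s hs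
    refine (B.le_opNorm₂ _ _).trans ?_
    gcongr
    exact hf s (Set.Ioo_subset_Icc_self hs)
  have hBm : ∀ {f : ℝ → E} {k : ℝ → F}, AEStronglyMeasurable f (volume.restrict I) →
      AEStronglyMeasurable k (volume.restrict I) →
      AEStronglyMeasurable (fun s => B (f s) (k s)) (volume.restrict I) := fun hf hk =>
    B.aestronglyMeasurable_comp₂ hf hk
  refine ⟨⟨hBm hgm hh.1, (key hC0 hC).trans_lt
    (ENNReal.mul_lt_top ENNReal.ofReal_lt_top hh.2)⟩, ?_⟩
  have t1 : Tendsto (fun n => eLpNorm (fun s => B (u n s - g s) (w n s - h s)) 2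
      (volume.restrict I)) atTop (𝓝 0) := by
    have hlim := ENNReal.Tendsto.const_mul (a := ENNReal.ofReal (‖B‖ * 1)) hwh
      (Or.inr ENNReal.ofReal_ne_top)
    rw [mul_zero] at hlim
    refine tendsto_of_tendsto_of_tendsto_of_le_of_le' tendsto_const_nhds hlim
      (Eventually.of_forall fun _ => zero_le) ?_
    filter_upwards [Metric.tendstoUniformlyOn_iff.1 H1 1 one_pos] with n hn
    refine key zero_le_one fun s hs => ?_
    rw [← dist_eq_norm, dist_comm]
    exact (hn s hs).le
  have t2 : Tendsto (fun n => eLpNorm (fun s => B (u n s - g s) (h s)) 2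
      (volume.restrict I)) atTop (𝓝 0) := by
    rw [ENNReal.tendsto_nhds_zero]
    intro ε hε
    have hlim : Tendsto (fun δ : ℝ => ENNReal.ofReal (‖B‖ * δ) * eLpNorm h 2 (volume.restrict I))
        (𝓝[>] 0) (𝓝 0) := by
      have h1 : Tendsto (fun δ : ℝ => ENNReal.ofReal (‖B‖ * δ)) (𝓝[>] 0) (𝓝 0) := by
        refine tendsto_nhdsWithin_of_tendsto_nhds ?_
        have : Continuous fun δ : ℝ => ENNReal.ofReal (‖B‖ * δ) :=
        ENNReal.continuous_ofReal.comp (continuous_const.mul continuous_id)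
        simpa using this.tendsto 0
      simpa using ENNReal.Tendsto.mul_const h1 (Or.inr hh.2.ne)
    obtain ⟨δ, hδ, hδ0⟩ := ((hlim.eventually (ge_mem_nhds hε)).and self_mem_nhdsWithin).exists
    filter_upwards [Metric.tendstoUniformlyOn_iff.1 H1 δ hδ0] with n hn
    refine (key (le_of_lt hδ0) fun s hs => ?_).trans hδ
    rw [← dist_eq_norm, dist_comm]
    exact (hn s hs).le
  have t3 : Tendsto (fun n => eLpNorm (fun s => B (g s) (w n s - h s)) 2
      (volume.restrict I)) atTop (𝓝 0) := by
    have hlim := ENNReal.Tendsto.const_mul (a := ENNReal.ofReal (‖B‖ * C)) hwh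
      (Or.inr ENNReal.ofReal_ne_top)
    rw [mul_zero] at hlim
    exact tendsto_of_tendsto_of_tendsto_of_le_of_le tendsto_const_nhds hlim
      (fun _ => zero_le) fun n => key hC0 hC
  have hlim := t1.add (t2.add t3)
  rw [add_zero, add_zero] at hlim
  refine tendsto_of_tendsto_of_tendsto_of_le_of_le tendsto_const_nhds hlim
    (fun _ => zero_le) fun n => ?_
  have hun := ((hu n).aestronglyMeasurable (μ := volume.restrict I)).sub hgm
  have hwn := ((hw n).aestronglyMeasurable (μ := volume.restrict I)).sub hh.1
  have m1 : AEStronglyMeasurable (fun s => B (u n s - g s) (w n s - h s)) (volume.restrict I) :=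
    hBm hun hwn
  have m2 : AEStronglyMeasurable (fun s => B (u n s - g s) (h s)) (volume.restrict I) :=
    hBm hun hh.1
  have m3 : AEStronglyMeasurable (fun s => B (g s) (w n s - h s)) (volume.restrict I) :=
    hBm hgm hwn
  have e : ((fun s => B (u n s) (w n s)) - fun s => B (g s) (h s)) =
      (fun s => B (u n s - g s) (w n s - h s)) + ((fun s => B (u n s - g s) (h s)) +
        fun s => B (g s) (w n s - h s)) := by
    ext s
    simp only [Pi.sub_apply, Pi.add_apply, map_sub, sub_apply]
    abel
  dsimp only
  rw [e]
  exact (eLpNorm_add_le m1 (m2.add m3) one_le_two).trans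
    (add_le_add_right (eLpNorm_add_le m2 m3 one_le_two) _)

lemma SobolevTendsto.zero_of_le [CompleteSpace E] {m : ℕ} {u : ℕ → ℝ → E} {g : ℝ → E}
    (hu : ∀ n, ContDiff ℝ ∞ (u n)) (H : SobolevTendsto m u g) : SobolevTendsto 0 u g := by
  induction m with
  | zero => exact H
  | succ m ih => exact ih (SobolevTendsto.continuousOn_and_uniform_and_mono hu H).2.2

lemma contDiff_bilinear (B : E →L[ℝ] F →L[ℝ] G) {n : WithTop ℕ∞} {u : ℝ → E} {w : ℝ → F}
    (hu : ContDiff ℝ n u) (hw : ContDiff ℝ n w) : ContDiff ℝ n (fun s => B (u s) (w s)) :=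
  B.isBoundedBilinearMap.contDiff.comp (hu.prodMk hw)

/-- `H^{m+1}(I)` is an algebra, in the form of continuity of bilinear maps. -/
lemma SobolevTendsto.bilinear [CompleteSpace E] [CompleteSpace F] [CompleteSpace G]
    (B : E →L[ℝ] F →L[ℝ] G) : ∀ {m : ℕ} {u : ℕ → ℝ → E} {g : ℝ → E} {w : ℕ → ℝ → F} {h : ℝ → F},
    (∀ n, ContDiff ℝ ∞ (u n)) → (∀ n, ContDiff ℝ ∞ (w n)) → SobolevTendsto (m + 1) u g →
      SobolevTendsto (m + 1) w h →
      SobolevTendsto (m + 1) (fun n s => B (u n s) (w n s)) (fun s => B (g s) (h s)) := by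
  intro m
  induction m with
  | zero =>
    intro u g w h hu hw hg hh
    obtain ⟨cg, ug, -⟩ := SobolevTendsto.continuousOn_and_uniform_and_mono hu hg
    obtain ⟨ch, uh, -⟩ := SobolevTendsto.continuousOn_and_uniform_and_mono hw hh
    obtain ⟨-, g1, hg1, -⟩ := hg
    obtain ⟨-, h1, hh1, -⟩ := hh
    have hu' := fun n => contDiff_infty_deriv (hu n)
    have hw' := fun n => contDiff_infty_deriv (hw n)
    have hB := fun n => contDiff_bilinear B (hu n) (hw n)
    refine SobolevTendsto.of_deriv hB (fun s hs => ?_)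
      (h := fun s => B (g s) (h1 s) + B.flip (h s) (g1 s)) ?_
    · exact (B.isBoundedBilinearMap.continuous.tendsto (g s, h s)).comp
        ((ug.tendsto_at hs).prodMk_nhds (uh.tendsto_at hs))
    · have a1 := SobolevTendsto.bilinear_zero B cg (fun n => (hu n).continuous)
        (fun n => (hw' n).continuous) ug hh1
      have a2 := SobolevTendsto.bilinear_zero B.flip ch (fun n => (hw n).continuous)
        (fun n => (hu' n).continuous) uh hg1
      have := SobolevTendsto.add (fun n => contDiff_bilinear B (hu n) (hw' n))
        (fun n => contDiff_bilinear B.flip (hw n) (hu' n)) a1 a2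
      convert this using 3 with n s
      exact (B.hasDerivAt_of_bilinear (fun _ => contDiff_infty_hasDerivAt (hu n) s)
        (fun _ => contDiff_infty_hasDerivAt (hw n) s)).deriv
  | succ m ih =>
    intro u g w h hu hw hg hh
    obtain ⟨cg, ug, hgm⟩ := SobolevTendsto.continuousOn_and_uniform_and_mono hu hg
    obtain ⟨ch, uh, hhm⟩ := SobolevTendsto.continuousOn_and_uniform_and_mono hw hh
    obtain ⟨-, g1, hg1, -⟩ := hg
    obtain ⟨-, h1, hh1, -⟩ := hh
    have hu' := fun n => contDiff_infty_deriv (hu n)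
    have hw' := fun n => contDiff_infty_deriv (hw n)
    have hB := fun n => contDiff_bilinear B (hu n) (hw n)
    refine SobolevTendsto.of_deriv hB (fun s hs => ?_)
      (h := fun s => B (g s) (h1 s) + B (g1 s) (h s)) ?_
    · exact (B.isBoundedBilinearMap.continuous.tendsto (g s, h s)).comp
        ((ug.tendsto_at hs).prodMk_nhds (uh.tendsto_at hs))
    · have := SobolevTendsto.add (fun n => contDiff_bilinear B (hu n) (hw' n))
        (fun n => contDiff_bilinear B (hu' n) (hw n)) (ih hu hw' hgm hh1) (ih hu' hw hg1 hhm)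
      convert this using 3 with n s
      exact (B.hasDerivAt_of_bilinear (fun _ => contDiff_infty_hasDerivAt (hu n) s)
        (fun _ => contDiff_infty_hasDerivAt (hw n) s)).deriv

lemma tendstoUniformlyOn_comp {u : ℕ → ℝ → ℝ} {g φ : ℝ → ℝ} (hφ : Continuous φ)
    (hg : ContinuousOn g (Set.Icc 0 1)) (hu : TendstoUniformlyOn u g atTop (Set.Icc 0 1)) :
    TendstoUniformlyOn (fun n s => φ (u n s)) (fun s => φ (g s)) atTop (Set.Icc 0 1) := by
  obtain ⟨C, hC⟩ := isCompact_Icc.exists_bound_of_continuousOn hg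
  have hφu : UniformContinuousOn φ (Metric.closedBall 0 (C + 1)) :=
    (isCompact_closedBall _ _).uniformContinuousOn_of_continuous hφ.continuousOn
  refine UniformContinuousOn.comp_tendstoUniformlyOn_eventually ?_ ?_ hφu hu
  · filter_upwards [Metric.tendstoUniformlyOn_iff.1 hu 1 one_pos] with n hn s hs
    rw [mem_closedBall_zero_iff]
    have h1 := hn s hs
    rw [dist_comm, dist_eq_norm] at h1
    calc ‖u n s‖ = ‖g s + (u n s - g s)‖ := by congr 1; ring
      _ ≤ ‖g s‖ + ‖u n s - g s‖ := norm_add_le _ _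
      _ ≤ C + 1 := add_le_add (hC s hs) h1.le
  · intro s hs
    rw [mem_closedBall_zero_iff]
    linarith [hC s hs]

/-- Composition with a smooth function is continuous on `H^{m+1}(I)`. -/
lemma SobolevTendsto.comp : ∀ {m : ℕ} {u : ℕ → ℝ → ℝ} {g φ : ℝ → ℝ},
    (∀ n, ContDiff ℝ ∞ (u n)) → ContDiff ℝ ∞ φ → SobolevTendsto (m + 1) u g →
      SobolevTendsto (m + 1) (fun n s => φ (u n s)) (fun s => φ (g s)) := by
  intro m
  induction m with
  | zero =>
    intro u g φ hu hφ hg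
    obtain ⟨cg, ug, -⟩ := SobolevTendsto.continuousOn_and_uniform_and_mono hu hg
    obtain ⟨-, g1, hg1, -⟩ := hg
    have hu' := fun n => contDiff_infty_deriv (hu n)
    have hφ' := contDiff_infty_deriv hφ
    refine SobolevTendsto.of_deriv (fun n => hφ.comp (hu n))
      (fun s hs => (hφ.continuous.tendsto _).comp (ug.tendsto_at hs))
      (h := fun s => ContinuousLinearMap.mul ℝ ℝ (deriv φ (g s)) (g1 s)) ?_
    have := SobolevTendsto.bilinear_zero (ContinuousLinearMap.mul ℝ ℝ) (g := fun s => deriv φ (g s))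
      (hφ'.continuous.comp_continuousOn cg) (fun n => hφ'.continuous.comp (hu n).continuous)
      (fun n => (hu' n).continuous) (tendstoUniformlyOn_comp hφ'.continuous cg ug) hg1
    convert this using 3 with n s
    exact ((contDiff_infty_hasDerivAt hφ (u n s)).comp s (contDiff_infty_hasDerivAt (hu n) s)).deriv
  | succ m ih =>
    intro u g φ hu hφ hg
    obtain ⟨cg, ug, hgm⟩ := SobolevTendsto.continuousOn_and_uniform_and_mono hu hg
    obtain ⟨-, g1, hg1, -⟩ := hg
    have hu' := fun n => contDiff_infty_deriv (hu n)
    have hφ' := contDiff_infty_deriv hφ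
    refine SobolevTendsto.of_deriv (fun n => hφ.comp (hu n))
      (fun s hs => (hφ.continuous.tendsto _).comp (ug.tendsto_at hs))
      (h := fun s => ContinuousLinearMap.mul ℝ ℝ (deriv φ (g s)) (g1 s)) ?_
    have := SobolevTendsto.bilinear (ContinuousLinearMap.mul ℝ ℝ)
      (fun n => hφ'.comp (hu n)) hu' (ih hu hφ' hgm) hg1
    convert this using 3 with n s
    exact ((contDiff_infty_hasDerivAt hφ (u n s)).comp s (contDiff_infty_hasDerivAt (hu n) s)).deriv

lemma SobolevTendsto.clm_comp [CompleteSpace E] [CompleteSpace F] (A : E →L[ℝ] F) :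
    ∀ {m : ℕ} {u : ℕ → ℝ → E} {g : ℝ → E}, (∀ n, ContDiff ℝ ∞ (u n)) → SobolevTendsto m u g →
      SobolevTendsto m (fun n s => A (u n s)) (fun s => A (g s)) := by
  intro m
  induction m with
  | zero =>
    rintro u g hu ⟨hg, hl⟩
    refine ⟨A.comp_memLp' hg, ?_⟩
    have hlim := ENNReal.Tendsto.const_mul (a := ENNReal.ofReal ‖A‖) hl
      (Or.inr ENNReal.ofReal_ne_top)
    rw [mul_zero] at hlim
    refine tendsto_of_tendsto_of_tendsto_of_le_of_le tendsto_const_nhds hlim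
      (fun _ => zero_le) fun n => ?_
    refine eLpNorm_le_mul_eLpNorm_of_ae_le_mul (ae_of_all _ fun s => ?_) 2
    simp only [Pi.sub_apply, ← map_sub]
    exact A.le_opNorm _
  | succ m ih =>
    rintro u g hu ⟨h0, h, hh, hg⟩
    have hu' := fun n => contDiff_infty_deriv (hu n)
    have hm := (SobolevTendsto.zero_of_le hu' hh).1
    refine ⟨(A.continuous.tendsto _).comp h0, fun s => A (h s), ?_, fun s hs => ?_⟩
    · convert ih hu' hh using 3 with n s
      exact (A.hasFDerivAt.comp_hasDerivAt s (contDiff_infty_hasDerivAt (hu n) s)).deriv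
    · dsimp only
      rw [hg s hs, map_add, A.intervalIntegral_comp_comm (intervalIntegrable_of_memLp hm hs)]

end SobolevConvergence

/-! ### Weak derivatives -/

section WeakDerivatives

lemma IsTestFunction.exists_eq_zero {φ : ℝ → ℝ} (hφ : IsTestFunction φ) :
    ∃ δ > 0, ∀ s, s < δ ∨ 1 - δ < s → φ s = 0 := by
  have hK : IsOpen (tsupport φ)ᶜ := (isClosed_tsupport φ).isOpen_compl
  have h0 : (0 : ℝ) ∈ (tsupport φ)ᶜ := fun h => (hφ.support h).1.false
  have h1 : (1 : ℝ) ∈ (tsupport φ)ᶜ := fun h => (hφ.support h).2.false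
  obtain ⟨α, hα, hα'⟩ := Metric.isOpen_iff.1 hK 0 h0
  obtain ⟨β, hβ, hβ'⟩ := Metric.isOpen_iff.1 hK 1 h1
  refine ⟨min α β, lt_min hα hβ, fun s hs => ?_⟩
  by_contra hne
  have hmem : s ∈ tsupport φ := subset_tsupport _ hne
  have hI := hφ.support hmem
  rcases hs with hs | hs
  · refine hα' ?_ hmem
    rw [Metric.mem_ball, Real.dist_eq, sub_zero, abs_of_pos hI.1]
    exact hs.trans_le (min_le_left _ _)
  · refine hβ' ?_ hmem
    rw [Metric.mem_ball, dist_comm, Real.dist_eq, abs_of_pos (by linarith [hI.2])]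
    linarith [min_le_right α β]

lemma isTestFunction_of_eq_zero {φ : ℝ → ℝ} (hφ : ContDiff ℝ ∞ φ) {δ : ℝ} (hδ : 0 < δ)
    (h : ∀ s, s < δ ∨ 1 - δ < s → φ s = 0) : IsTestFunction φ := by
  have hs : tsupport φ ⊆ Set.Icc δ (1 - δ) := by
    refine closure_minimal (fun s hs => ?_) isClosed_Icc
    by_contra hc
    refine hs (h s ?_)
    by_contra! h'
    exact hc h'
  exact ⟨hφ, isCompact_Icc.of_isClosed_subset (isClosed_tsupport _) hs,
    hs.trans fun s hs => ⟨hδ.trans_le hs.1, by linarith [hs.2]⟩⟩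

lemma IsTestFunction.deriv {φ : ℝ → ℝ} (hφ : IsTestFunction φ) : IsTestFunction (deriv φ) :=
  ⟨contDiff_infty_deriv hφ.smooth, hφ.compact.deriv, tsupport_deriv_subset.trans hφ.support⟩

lemma IsTestFunction.iteratedDeriv {φ : ℝ → ℝ} (hφ : IsTestFunction φ) (j : ℕ) :
    IsTestFunction (iteratedDeriv j φ) := by
  induction j with
  | zero => simpa using hφ
  | succ j ih => rw [iteratedDeriv_succ]; exact ih.deriv

lemma IsTestFunction.integrableOn_mul {φ u : ℝ → ℝ} (hφ : IsTestFunction φ)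
    (hu : LocallyIntegrableOn u I) : IntegrableOn (fun s => u s * φ s) I := by
  have h1 : IntegrableOn (fun s => u s * φ s) (tsupport φ) :=
    (hu.integrableOn_compact_subset hφ.support hφ.compact).mul_continuousOn
      hφ.smooth.continuous.continuousOn hφ.compact
  refine ((integrableOn_iff_integrable_of_support_subset fun s hs => ?_).1 h1).integrableOn
  exact subset_tsupport _ (right_ne_zero_of_mul hs)

lemma locallyIntegrableOn_of_memLp {u : ℝ → ℝ} (hu : MemLp u 2 (volume.restrict I)) :
    LocallyIntegrableOn u I :=
  IntegrableOn.locallyIntegrableOn (hu.integrable one_le_two)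

/-- A function which annihilates all test functions vanishes almost everywhere in `I`. -/
lemma ae_eq_of_forall_integral_mul {u w : ℝ → ℝ} (hu : LocallyIntegrableOn u I)
    (hw : LocallyIntegrableOn w I)
    (h : ∀ φ, IsTestFunction φ → ∫ s in I, u s * φ s = ∫ s in I, w s * φ s) :
    u =ᵐ[volume.restrict I] w := by
  have := isOpen_Ioo.ae_eq_zero_of_integral_contDiff_smul_eq_zero (U := I) (μ := volume)
    (hu.sub hw) fun φ h1 h2 h3 => ?_
  · rw [EventuallyEq, ae_restrict_iff' measurableSet_Ioo]
    filter_upwards [this] with s hs hsI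
    exact sub_eq_zero.1 (hs hsI)
  · have hφ : IsTestFunction φ := ⟨h1, h2, h3⟩
    rw [← setIntegral_eq_integral_of_forall_compl_eq_zero (s := I)]
    · have := integral_sub (hφ.integrableOn_mul hu) (hφ.integrableOn_mul hw)
      rw [h φ hφ, sub_self] at this
      rw [← this]
      refine integral_congr_ae (ae_of_all _ fun s => ?_)
      simp only [Pi.sub_apply, smul_eq_mul]
      ring
    · intro s hs
      rw [image_eq_zero_of_notMem_tsupport fun h => hs (h3 h), zero_smul]

lemma IsWeakDeriv.ae_eq {j : ℕ} {u u' w w' : ℝ → ℝ} (h : IsWeakDeriv j u w)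
    (h' : IsWeakDeriv j u' w') (hu : u =ᵐ[volume.restrict I] u') :
    w =ᵐ[volume.restrict I] w' := by
  refine ae_eq_of_forall_integral_mul h.locInt_deriv h'.locInt_deriv fun φ hφ => ?_
  have h1 := h.integral_eq φ hφ
  have h2 := h'.integral_eq φ hφ
  have h3 : ∫ s in I, u s * iteratedDeriv j φ s = ∫ s in I, u' s * iteratedDeriv j φ s :=
    integral_congr_ae (by filter_upwards [hu] with s hs; rw [hs])
  rw [h1, h2] at h3
  exact mul_left_cancel₀ (pow_ne_zero j (by norm_num)) h3

lemma IsWeakDeriv.congr {j : ℕ} {u u' w w' : ℝ → ℝ} (h : IsWeakDeriv j u w)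
    (hu : u =ᵐ[volume.restrict I] u') (hw : w =ᵐ[volume.restrict I] w') : IsWeakDeriv j u' w' := by
  refine ⟨h.locInt.congr hu, h.locInt_deriv.congr hw, fun φ hφ => ?_⟩
  have h1 : ∫ s in I, u s * iteratedDeriv j φ s = ∫ s in I, u' s * iteratedDeriv j φ s :=
    integral_congr_ae (by filter_upwards [hu] with s hs; rw [hs])
  have h2 : ∫ s in I, w s * φ s = ∫ s in I, w' s * φ s :=
    integral_congr_ae (by filter_upwards [hw] with s hs; rw [hs])
  rw [← h1, ← h2, h.integral_eq φ hφ]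

lemma IsWeakDeriv.weakDeriv_ae_eq {j : ℕ} {u w : ℝ → ℝ} (h : IsWeakDeriv j u w) :
    weakDeriv j u =ᵐ[volume.restrict I] w := by
  have hex : ∃ w, IsWeakDeriv j u w := ⟨w, h⟩
  have : weakDeriv j u = hex.choose := dif_pos hex
  rw [this]
  exact hex.choose_spec.ae_eq h (ae_eq_refl u)

lemma IsWeakDeriv.sub {j : ℕ} {u u' w w' : ℝ → ℝ} (h : IsWeakDeriv j u w)
    (h' : IsWeakDeriv j u' w') :
    IsWeakDeriv j (fun s => u s - u' s) (fun s => w s - w' s) := by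
  refine ⟨h.locInt.sub h'.locInt, h.locInt_deriv.sub h'.locInt_deriv, fun φ hφ => ?_⟩
  have hj := hφ.iteratedDeriv j
  simp only [sub_mul]
  rw [integral_sub (hj.integrableOn_mul h.locInt) (hj.integrableOn_mul h'.locInt),
    integral_sub (hφ.integrableOn_mul h.locInt_deriv) (hφ.integrableOn_mul h'.locInt_deriv),
    h.integral_eq φ hφ, h'.integral_eq φ hφ, mul_sub]

/-- Integration by parts against a test function. -/
lemma integral_mul_deriv_test {u φ : ℝ → ℝ} (hu : ContDiff ℝ 1 u) (hφ : IsTestFunction φ) :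
    ∫ s in I, u s * deriv φ s = -∫ s in I, deriv u s * φ s := by
  obtain ⟨δ, hδ, h⟩ := hφ.exists_eq_zero
  have := intervalIntegral.integral_mul_deriv_eq_deriv_mul (a := 0) (b := 1)
    (fun s _ => (hu.differentiable one_ne_zero s).hasDerivAt)
    (fun s _ => contDiff_infty_hasDerivAt hφ.smooth s)
    ((hu.continuous_deriv le_rfl).intervalIntegrable _ _)
    ((contDiff_infty_deriv hφ.smooth).continuous.intervalIntegrable _ _)
  rw [h 0 (Or.inl hδ), h 1 (Or.inr (by linarith))] at this
  rw [← integral_Ioc_eq_integral_Ioo, ← integral_Ioc_eq_integral_Ioo,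
    ← intervalIntegral.integral_of_le zero_le_one, ← intervalIntegral.integral_of_le zero_le_one,
    this]
  simp

/-- Classical derivatives are weak derivatives. -/
lemma isWeakDeriv_iteratedDeriv : ∀ {j : ℕ} {u : ℝ → ℝ}, ContDiff ℝ j u →
    IsWeakDeriv j u (iteratedDeriv j u) := by
  intro j u hu
  refine ⟨locallyIntegrableOn_of_memLp (memLp_of_continuousOn hu.continuous.continuousOn 2),
    locallyIntegrableOn_of_memLp
      (memLp_of_continuousOn (hu.continuous_iteratedDeriv' j).continuousOn 2), ?_⟩
  induction j generalizing u with
  | zero => intro φ _; simp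
  | succ j ih =>
    intro φ hφ
    have h1 : ContDiff ℝ 1 u := hu.of_le (by exact_mod_cast Nat.le_add_left 1 j)
    have h2 : ContDiff ℝ j (deriv u) := by
      have := (contDiff_succ_iff_deriv (n := (j : WithTop ℕ∞)) (f := u)).1 (by exact_mod_cast hu)
      exact this.2.2
    rw [iteratedDeriv_succ, integral_mul_deriv_test h1 (hφ.iteratedDeriv j), ih h2 φ hφ,
      iteratedDeriv_succ', pow_succ]
    ring

lemma tendsto_integral_mul_test {u : ℕ → ℝ → ℝ} {g φ : ℝ → ℝ} (hu : ∀ n, Continuous (u n))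
    (H : SobolevTendsto 0 u g) (hφ : Continuous φ) :
    Tendsto (fun n => ∫ s in I, u n s * φ s) atTop (𝓝 (∫ s in I, g s * φ s)) := by
  have h1 := SobolevTendsto.bilinear_zero (ContinuousLinearMap.mul ℝ ℝ) (u := fun _ => φ) (g := φ)
    hφ.continuousOn (fun _ => hφ) hu
    (by rw [Metric.tendstoUniformlyOn_iff]; intro ε hε; simp [hε]) H
  have h2 := (tendstoUniformlyOn_integral
    (fun n => hφ.mul (hu n)) h1).tendsto_at (x := 1) (by simp)
  have e : ∀ f : ℝ → ℝ, ∫ s in I, f s * φ s = ∫ t in (0 : ℝ)..1, φ t * f t := fun f => by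
    rw [intervalIntegral.integral_of_le zero_le_one, integral_Ioc_eq_integral_Ioo]
    simp only [mul_comm]
  simp only [e]
  exact h2

/-- Weak differentiation is closed with respect to convergence in `L²(I)`. -/
lemma isWeakDeriv_of_tendsto {j : ℕ} {u : ℕ → ℝ → ℝ} {g w : ℝ → ℝ} (hu : ∀ n, ContDiff ℝ ∞ (u n))
    (hg : SobolevTendsto 0 u g) (hw : SobolevTendsto 0 (fun n => iteratedDeriv j (u n)) w) :
    IsWeakDeriv j g w := by
  refine ⟨locallyIntegrableOn_of_memLp hg.1, locallyIntegrableOn_of_memLp hw.1, fun φ hφ => ?_⟩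
  have h1 := tendsto_integral_mul_test (fun n => (hu n).continuous) hg
    (hφ.iteratedDeriv j).smooth.continuous
  have h2 := (tendsto_integral_mul_test
    (fun n => (hu n).continuous_iteratedDeriv j (by exact_mod_cast le_top)) hw
    hφ.smooth.continuous).const_mul ((-1) ^ j)
  refine tendsto_nhds_unique h1 (h2.congr fun n => ?_)
  exact ((isWeakDeriv_iteratedDeriv
    ((hu n).of_le (by exact_mod_cast le_top))).integral_eq φ hφ).symm

/-- The derivatives of order `j ≤ m` of a sequence converging in `H^m(I)` converge in `L²(I)`. -/
lemma SobolevTendsto.exists_iteratedDeriv {E : Type*} [NormedAddCommGroup E] [NormedSpace ℝ E]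
    [CompleteSpace E] {m : ℕ} : ∀ {u : ℕ → ℝ → E} {g : ℝ → E}, (∀ n, ContDiff ℝ ∞ (u n)) →
    SobolevTendsto m u g → ∀ j ≤ m, ∃ w, SobolevTendsto 0 (fun n => iteratedDeriv j (u n)) w := by
  induction m with
  | zero =>
    intro u g _ H j hj
    obtain rfl : j = 0 := by omega
    exact ⟨g, by simpa using H⟩
  | succ m ih =>
    intro u g hu H j hj
    rcases j with _ | j
    · exact ⟨g, by simpa using SobolevTendsto.zero_of_le hu H⟩
    · obtain ⟨-, h, hh, -⟩ := H
      obtain ⟨w, hw⟩ := ih (fun n => contDiff_infty_deriv (hu n)) hh j (by omega)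
      exact ⟨w, by simpa only [iteratedDeriv_succ'] using hw⟩

/-- The du Bois-Reymond lemma: a function with vanishing weak derivative is constant. -/
lemma exists_ae_eq_const {u : ℝ → ℝ} (hu : LocallyIntegrableOn u I)
    (h : ∀ φ, IsTestFunction φ → ∫ s in I, u s * deriv φ s = 0) :
    ∃ c : ℝ, u =ᵐ[volume.restrict I] fun _ => c := by
  -- a test function `θ` of integral one
  obtain ⟨θ, hθ, hθ1⟩ : ∃ θ, IsTestFunction θ ∧ ∫ s in I, θ s = 1 := by
    let b : ContDiffBump (1 / 2 : ℝ) := ⟨1 / 8, 1 / 4, by norm_num, by norm_num⟩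
    have ht : IsTestFunction b := by
      refine ⟨b.contDiff, b.hasCompactSupport, ?_⟩
      rw [b.tsupport_eq, Real.closedBall_eq_Icc]
      intro s hs
      constructor <;> [linarith [hs.1, show b.rOut = 1 / 4 from rfl];
        linarith [hs.2, show b.rOut = 1 / 4 from rfl]]
    have hb : ∫ s in I, b s = ∫ s, b s := by
      refine setIntegral_eq_integral_of_forall_compl_eq_zero fun s hs => ?_
      exact image_eq_zero_of_notMem_tsupport fun h => hs (ht.support h)
    have hpos : 0 < ∫ s, b s := b.integral_pos
    refine ⟨fun s => b s / ∫ s, b s, ?_, ?_⟩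
    · obtain ⟨δ, hδ, h0⟩ := ht.exists_eq_zero
      exact isTestFunction_of_eq_zero (ht.smooth.div_const _) hδ fun s hs => by simp [h0 s hs]
    · rw [integral_div, hb, div_self hpos.ne']
  refine ⟨∫ s in I, u s * θ s, ?_⟩
  refine ae_eq_of_forall_integral_mul hu
    (locallyIntegrableOn_of_memLp (memLp_const _)) fun ψ hψ => ?_
  -- `ψ - (∫ ψ) θ` has a primitive which is a test function
  set m := ∫ s in I, ψ s with hm
  obtain ⟨δ₁, hδ₁, h1⟩ := hψ.exists_eq_zero
  obtain ⟨δ₂, hδ₂, h2⟩ := hθ.exists_eq_zero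
  set f : ℝ → ℝ := fun s => ψ s - m * θ s with hf
  have hfs : ContDiff ℝ ∞ f := hψ.smooth.sub (contDiff_const.mul hθ.smooth)
  have hf0 : ∀ s, s < min δ₁ δ₂ ∨ 1 - min δ₁ δ₂ < s → f s = 0 := by
    intro s hs
    have e1 := min_le_left δ₁ δ₂
    have e2 := min_le_right δ₁ δ₂
    rw [hf]
    dsimp only
    rw [h1 s (hs.imp (fun h => by linarith) fun h => by linarith),
      h2 s (hs.imp (fun h => by linarith) fun h => by linarith)]
    ring
  have hint : ∫ t in (0 : ℝ)..1, f t = 0 := by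
    rw [intervalIntegral.integral_of_le zero_le_one, integral_Ioc_eq_integral_Ioo, hf,
      integral_sub (memLp_one_iff_integrable.1
        (memLp_of_continuousOn hψ.smooth.continuous.continuousOn 1))
      ((memLp_one_iff_integrable.1
        (memLp_of_continuousOn hθ.smooth.continuous.continuousOn 1)).const_mul m),
      integral_const_mul, hθ1, ← hm]
    ring
  have hmin : 0 < min δ₁ δ₂ := lt_min hδ₁ hδ₂
  have hφ : IsTestFunction (fun s => ∫ t in (0 : ℝ)..s, f t) := by
    refine isTestFunction_of_eq_zero (contDiff_primitive hfs) hmin fun s hs => ?_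
    rcases hs with hs | hs
    · refine (intervalIntegral.integral_congr (g := fun _ => 0) fun t ht => hf0 t (Or.inl ?_)).trans
        (by simp)
      exact (Set.mem_uIcc.1 ht).elim (fun h => h.2.trans_lt hs) fun h => h.2.trans_lt hmin
    · rw [← intervalIntegral.integral_add_adjacent_intervals
        (hfs.continuous.intervalIntegrable 0 1) (hfs.continuous.intervalIntegrable 1 s), hint,
        zero_add]
      refine (intervalIntegral.integral_congr (g := fun _ => 0) fun t ht => hf0 t (Or.inr ?_)).trans
        (by simp)
      exact (Set.mem_uIcc.1 ht).elim (fun h => by linarith [h.1]) fun h => by linarith [h.1]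
  have h3 := h _ hφ
  rw [deriv_primitive hfs.continuous] at h3
  have h4 : ∫ s in I, u s * f s = (∫ s in I, u s * ψ s) - m * ∫ s in I, u s * θ s := by
    rw [← integral_const_mul, ← integral_sub (hψ.integrableOn_mul hu)
      ((hθ.integrableOn_mul hu).const_mul m)]
    refine integral_congr_ae (ae_of_all _ fun s => ?_)
    simp only [hf]
    ring
  rw [integral_const_mul, ← hm, mul_comm]
  linarith

end WeakDerivatives

/-! ### Approximation by functions symmetric near the endpoints -/

section Approximation

variable {E : Type*} [NormedAddCommGroup E] [NormedSpace ℝ E]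

/-- Smooth functions supported in the interior of `I` are dense in `L²(I)`. -/
lemma exists_smooth_eLpNorm_sub_le {f : ℝ → E} (hf : MemLp f 2 (volume.restrict I)) {ε : ℝ}
    (hε : 0 < ε) : ∃ g : ℝ → E, ContDiff ℝ ∞ g ∧
      (∃ η > 0, ∀ s, s < η ∨ 1 - η < s → g s = 0) ∧
      eLpNorm (g - f) 2 (volume.restrict I) ≤ ENNReal.ofReal ε := by
  have hε2 : 0 < ε / 2 := half_pos hε
  obtain ⟨δ, hδ, hδf⟩ := hf.eLpNorm_indicator_le one_le_two ENNReal.ofNat_ne_top hε2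
  obtain ⟨k, -, hk, hkf⟩ :=
    ((memLp_indicator_iff_restrict measurableSet_Ioo).2 hf).exist_eLpNorm_sub_le
    ENNReal.ofNat_ne_top one_le_two hε2
  set η := δ / 2 with hη
  have hη0 : 0 < η := half_pos hδ
  set χ : ℝ → ℝ := fun s => Real.smoothTransition (2 * s / η - 1) *
    Real.smoothTransition (2 * (1 - s) / η - 1) with hχ
  have hχs : ContDiff ℝ ∞ χ := by
    refine (Real.smoothTransition.contDiff.comp ?_).mul (Real.smoothTransition.contDiff.comp ?_)
    · fun_prop
    · fun_prop
  have hχ0 : ∀ s, 0 ≤ χ s := fun s =>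
    mul_nonneg (Real.smoothTransition.nonneg _) (Real.smoothTransition.nonneg _)
  have hχ1 : ∀ s, χ s ≤ 1 := fun s => mul_le_one₀ (Real.smoothTransition.le_one _)
    (Real.smoothTransition.nonneg _) (Real.smoothTransition.le_one _)
  have hχI : ∀ s ∈ Set.Icc η (1 - η), χ s = 1 := fun s hs => by
    have h1 : 1 ≤ 2 * s / η - 1 := by
      rw [le_sub_iff_add_le, le_div_iff₀ hη0]; linarith [hs.1]
    have h2 : 1 ≤ 2 * (1 - s) / η - 1 := by
      rw [le_sub_iff_add_le, le_div_iff₀ hη0]; linarith [hs.2]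
    simp [hχ, Real.smoothTransition.one_of_one_le h1, Real.smoothTransition.one_of_one_le h2]
  set A : Set ℝ := Set.Ioo 0 η ∪ Set.Ioo (1 - η) 1 with hA
  have hAm : MeasurableSet A := measurableSet_Ioo.union measurableSet_Ioo
  have hAv : (volume.restrict I) A ≤ ENNReal.ofReal δ := by
    refine (Measure.restrict_apply_le _ _).trans ((measure_union_le _ _).trans ?_)
    rw [Real.volume_Ioo, Real.volume_Ioo, ← ENNReal.ofReal_add (by linarith) (by linarith)]
    exact ENNReal.ofReal_le_ofReal (by rw [hη]; linarith)
  refine ⟨fun s => χ s • k s, hχs.smul hk, ⟨η / 2, half_pos hη0, fun s hs => ?_⟩, ?_⟩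
  · have : χ s = 0 := by
      rcases hs with hs | hs
      · have : 2 * s / η - 1 ≤ 0 := by rw [sub_nonpos, div_le_one hη0]; linarith
        simp [hχ, Real.smoothTransition.zero_of_nonpos this]
      · have : 2 * (1 - s) / η - 1 ≤ 0 := by rw [sub_nonpos, div_le_one hη0]; linarith
        simp [hχ, Real.smoothTransition.zero_of_nonpos this]
    simp only [this, zero_smul]
  · -- `χ k - f = χ (k - f) - (1 - χ) f`, and `1 - χ` is supported in the small set `A`
    have hm1 : AEStronglyMeasurable (fun s => χ s • (k s - f s)) (volume.restrict I) :=
      hχs.continuous.aestronglyMeasurable.smul (hk.continuous.aestronglyMeasurable.sub hf.1)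
    have hm2 : AEStronglyMeasurable (fun s => (1 - χ s) • f s) (volume.restrict I) :=
      (continuous_const.sub hχs.continuous).aestronglyMeasurable.smul hf.1
    have e : (fun s => χ s • k s) - f = (fun s => χ s • (k s - f s)) -
        fun s => (1 - χ s) • f s := by
      ext s
      simp only [Pi.sub_apply, smul_sub, sub_smul, one_smul]
      abel
    have b1 : eLpNorm (fun s => χ s • (k s - f s)) 2 (volume.restrict I) ≤
        ENNReal.ofReal (ε / 2) := by
      refine le_trans (eLpNorm_mono_ae (g := Set.indicator I f - k) ?_)
        ((eLpNorm_mono_measure _ Measure.restrict_le_self).trans hkf)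
      filter_upwards [ae_restrict_mem measurableSet_Ioo] with s hs
      rw [Pi.sub_apply, Set.indicator_of_mem hs, norm_smul, Real.norm_of_nonneg (hχ0 s),
        norm_sub_rev]
      exact mul_le_of_le_one_left (norm_nonneg _) (hχ1 s)
    have b2 : eLpNorm (fun s => (1 - χ s) • f s) 2 (volume.restrict I) ≤
        ENNReal.ofReal (ε / 2) := by
      refine le_trans (eLpNorm_mono_ae (g := A.indicator f) ?_) (hδf A hAm hAv)
      filter_upwards [ae_restrict_mem measurableSet_Ioo] with s hs
      by_cases hsA : s ∈ A
      · rw [Set.indicator_of_mem hsA, norm_smul, Real.norm_of_nonneg (by linarith [hχ1 s])]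
        exact mul_le_of_le_one_left (norm_nonneg _) (by linarith [hχ0 s])
      · have : s ∈ Set.Icc η (1 - η) := by
          rw [hA, Set.mem_union, not_or] at hsA
          exact ⟨not_lt.1 fun h => hsA.1 ⟨hs.1, h⟩, not_lt.1 fun h => hsA.2 ⟨h, hs.2⟩⟩
        rw [hχI s this]
        simp
    rw [e]
    refine (eLpNorm_sub_le hm1 hm2 one_le_two).trans ((add_le_add b1 b2).trans ?_)
    rw [← ENNReal.ofReal_add hε2.le hε2.le, add_halves]

lemma exists_smooth_sobolevTendsto_zero {f : ℝ → E} (hf : MemLp f 2 (volume.restrict I)) :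
    ∃ u : ℕ → ℝ → E, (∀ n, ContDiff ℝ ∞ (u n)) ∧
      (∀ n, ∃ η > 0, ∀ s, s < η ∨ 1 - η < s → u n s = 0) ∧ SobolevTendsto 0 u f := by
  choose u h1 h2 h3 using fun n : ℕ =>
    exists_smooth_eLpNorm_sub_le hf (Nat.one_div_pos_of_nat (n := n))
  refine ⟨u, h1, h2, hf, ?_⟩
  refine tendsto_of_tendsto_of_tendsto_of_le_of_le tendsto_const_nhds ?_ (fun _ => zero_le) h3
  simpa using ENNReal.tendsto_ofReal (tendsto_one_div_add_atTop_nhds_zero_nat (𝕜 := ℝ))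

/-- `g` is an `m`-fold primitive of a function in `L²(ℝ)`. These are the continuous representatives
of the elements of `H^m(I)`, extended beyond `I`. -/
def SobolevRep : ℕ → (ℝ → E) → Prop
  | 0, g => MemLp g 2 volume
  | m + 1, g => ∃ h, SobolevRep m h ∧ ∀ s, g s = g 0 + ∫ t in (0 : ℝ)..s, h t

lemma tendsto_two_mul_sub (p : ℝ) : Tendsto (fun s : ℝ => 2 * p - s) (𝓝 p) (𝓝 p) := by
  have : Continuous fun s : ℝ => 2 * p - s := by fun_prop
  simpa [two_mul] using this.tendsto p

/-- If the derivative of `u` satisfies `u' (2p - s) = -R (u' s)` near `p` and `u p` is fixed by `R`,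
then `u (2p - s) = R (u s)` near `p`. -/
lemma eventually_reflect_eq {u U : ℝ → E} {R : E →L[ℝ] E} {p : ℝ} (hu : ContDiff ℝ ∞ u)
    (hU : deriv u =ᶠ[𝓝 p] U) (hR : ∀ᶠ s in 𝓝 p, U (2 * p - s) = -R (U s)) (hp : u p = R (u p)) :
    ∀ᶠ s in 𝓝 p, u (2 * p - s) = R (u s) := by
  have hd : ∀ s, HasDerivAt (fun s => u (2 * p - s) - R (u s))
      (-deriv u (2 * p - s) - R (deriv u s)) s := fun s => by
    have h1 := (contDiff_infty_hasDerivAt hu (2 * p - s)).scomp s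
      ((hasDerivAt_id s).const_sub (2 * p))
    have h2 := R.hasFDerivAt.comp_hasDerivAt s (contDiff_infty_hasDerivAt hu s)
    simpa using h1.fun_sub h2
  have ht := tendsto_two_mul_sub p
  have hz : ∀ᶠ s in 𝓝 p, -deriv u (2 * p - s) - R (deriv u s) = 0 := by
    filter_upwards [hU, ht.eventually hU, hR] with s h1 h2 h3
    rw [h1, h2, h3]
    simp
  obtain ⟨δ, hδ, hδz⟩ := Metric.eventually_nhds_iff_ball.1 hz
  filter_upwards [Metric.ball_mem_nhds p hδ] with s hs
  have := Metric.isOpen_ball.is_const_of_deriv_eq_zero (convex_ball p δ).isPreconnected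
    (fun s _ => (hd s).differentiableAt.differentiableWithinAt)
    (fun s hs => by rw [(hd s).deriv, hδz s hs]; rfl) hs (Metric.mem_ball_self hδ)
  rw [two_mul, add_sub_cancel_right, ← hp, sub_self, sub_eq_zero] at this
  rw [two_mul, this]

variable [CompleteSpace E]

/-- An `(m+1)`-fold primitive is of class `C^m`. Integrability of `m`-fold primitives is proved in
the same induction because the case `m = 0` is not covered by continuity. -/
lemma SobolevRep.regularity {m : ℕ} : ∀ {g : ℝ → E},
    (SobolevRep m g → ∀ a b, IntervalIntegrable g volume a b) ∧
    (SobolevRep (m + 1) g → ContDiff ℝ m g) := by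
  have hprim : ∀ {g h : ℝ → E}, (∀ a b, IntervalIntegrable h volume a b) →
      (∀ s, g s = g 0 + ∫ t in (0 : ℝ)..s, h t) → Continuous g := fun {g h} hi hg => by
    rw [funext hg]
    exact continuous_const.add (intervalIntegral.continuous_primitive hi 0)
  induction m with
  | zero =>
    have h0 : ∀ {g : ℝ → E}, SobolevRep 0 g → ∀ a b, IntervalIntegrable g volume a b :=
      fun hg a b => ((MeasureTheory.MemLp.locallyIntegrable hg one_le_two).integrableOn_isCompact
        isCompact_uIcc).intervalIntegrable
    refine fun {g} => ⟨h0, fun ⟨h, hh, hg⟩ => ?_⟩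
    exact_mod_cast contDiff_zero.2 (hprim (h0 hh) hg)
  | succ m ih =>
    have h1 : ∀ {g : ℝ → E}, SobolevRep (m + 1) g → ∀ a b, IntervalIntegrable g volume a b :=
      fun hg a b => (ih.2 hg).continuous.intervalIntegrable a b
    refine fun {g} => ⟨h1, fun ⟨h, hh, hg⟩ => ?_⟩
    have hc := (ih.2 hh).continuous
    have hd : ∀ s, HasDerivAt g (h s) s := fun s => by
      rw [funext hg]
      exact (hasDerivAt_primitive hc s).const_add _
    have hd' : deriv g = h := funext fun s => (hd s).deriv
    rw [Nat.cast_succ, contDiff_succ_iff_deriv]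
    refine ⟨fun s => (hd s).differentiableAt, by simp, ?_⟩
    rw [hd']
    exact ih.2 hh

lemma deriv_eq_of_eq_integral {g h : ℝ → E} (hh : Continuous h)
    (hg : ∀ s, g s = g 0 + ∫ t in (0 : ℝ)..s, h t) : deriv g = h := by
  ext1 s
  rw [funext hg]
  exact ((hasDerivAt_primitive hh s).const_add _).deriv

/-- Multiples of a fixed smooth function by vectors tending to zero tend to zero in every `H^m(I)`.
-/
lemma sobolevTendsto_smul_const {ψ : ℝ → ℝ} {κ : ℕ → E} (hκ : Tendsto κ atTop (𝓝 0)) {m : ℕ}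
    (hψ : ContDiff ℝ ∞ ψ) : SobolevTendsto m (fun n s => ψ s • κ n) (fun _ => (0 : E)) := by
  induction m generalizing ψ with
  | zero =>
    refine ⟨memLp_const 0, tendsto_eLpNorm_of_tendstoUniformlyOn ?_⟩
    obtain ⟨C, hC⟩ := isCompact_Icc.exists_bound_of_continuousOn
      (hψ.continuous.continuousOn (s := Set.Icc 0 1))
    rw [Metric.tendstoUniformlyOn_iff]
    intro ε hε
    have h1 : Tendsto (fun n => C * ‖κ n‖) atTop (𝓝 0) := by simpa using (hκ.norm).const_mul C
    filter_upwards [h1.eventually (gt_mem_nhds hε)] with n hn s hs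
    rw [dist_zero_left, norm_smul]
    exact (mul_le_mul_of_nonneg_right (hC s hs) (norm_nonneg _)).trans_lt hn
  | succ m ih =>
    refine SobolevTendsto.of_deriv (fun n => hψ.smul contDiff_const) (fun s _ => ?_)
      (h := fun _ => 0) ?_
    · simpa using hκ.const_smul (ψ s)
    · convert ih (contDiff_infty_deriv hψ) using 3 with n s
      exact ((contDiff_infty_hasDerivAt hψ s).smul_const (κ n)).deriv

/-- A smooth step from `0` to `1`, constant near both endpoints of `I`. -/
lemma exists_smooth_step : ∃ χ : ℝ → ℝ, ContDiff ℝ ∞ χ ∧ χ 0 = 0 ∧ χ 1 = 1 ∧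
    ∀ p : ℝ, p = 0 ∨ p = 1 → deriv χ =ᶠ[𝓝 p] 0 := by
  have h0 : ∀ s : ℝ, s < 1 / 3 → Real.smoothTransition (3 * s - 1) = 0 := fun s hs =>
    Real.smoothTransition.zero_of_nonpos (by linarith)
  have h1 : ∀ s : ℝ, 2 / 3 < s → Real.smoothTransition (3 * s - 1) = 1 := fun s hs =>
    Real.smoothTransition.one_of_one_le (by linarith)
  refine ⟨fun s => Real.smoothTransition (3 * s - 1), Real.smoothTransition.contDiff.comp
    (by fun_prop), h0 0 (by norm_num), h1 1 (by norm_num), ?_⟩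
  rintro p (rfl | rfl)
  · have : (fun s : ℝ => Real.smoothTransition (3 * s - 1)) =ᶠ[𝓝 0] fun _ => 0 := by
      filter_upwards [gt_mem_nhds (show (0 : ℝ) < 1 / 3 by norm_num)] with s hs using h0 s hs
    refine this.deriv.trans (Eventually.of_forall fun s => ?_)
    simp
  · have : (fun s : ℝ => Real.smoothTransition (3 * s - 1)) =ᶠ[𝓝 1] fun _ => 1 := by
      filter_upwards [lt_mem_nhds (show (2 / 3 : ℝ) < 1 by norm_num)] with s hs using h1 s hs
    refine this.deriv.trans (Eventually.of_forall fun s => ?_)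
    simp

/-- If the derivatives of order less than `m` of `g` at each endpoint `p` of `I` are those of a
function with the symmetry `g (2p - s) = R p (g s)`, then `g` is a limit in `H^m(I)` of smooth
functions which have this symmetry near the endpoints. -/
theorem exists_symmetric_sobolevTendsto {m : ℕ} : ∀ {g : ℝ → E} {R : ℝ → E →L[ℝ] E},
    SobolevRep m g →
    (∀ p : ℝ, p = 0 ∨ p = 1 → ∀ j < m,
      iteratedDeriv j g p = (-1 : ℝ) ^ j • R p (iteratedDeriv j g p)) →
    ∃ u : ℕ → ℝ → E, (∀ n, ContDiff ℝ ∞ (u n)) ∧ SobolevTendsto m u g ∧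
      ∀ p : ℝ, p = 0 ∨ p = 1 → ∀ n, (∀ᶠ s in 𝓝 p, u n (2 * p - s) = R p (u n s)) ∧
        (0 < m → u n p = g p) := by
  induction m with
  | zero =>
    intro g R hg _
    obtain ⟨u, h1, h2, h3⟩ := exists_smooth_sobolevTendsto_zero
      (f := g) (MeasureTheory.MemLp.restrict I hg)
    refine ⟨u, h1, h3, fun p hp n => ⟨?_, fun h => absurd h (lt_irrefl 0)⟩⟩
    obtain ⟨η, hη, h0⟩ := h2 n
    have hz : ∀ᶠ s in 𝓝 p, u n s = 0 := by
      rcases hp with rfl | rfl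
      · filter_upwards [gt_mem_nhds hη] with s hs using h0 s (Or.inl hs)
      · filter_upwards [lt_mem_nhds (show 1 - η < 1 by linarith)] with s hs using h0 s (Or.inr hs)
    have ht := tendsto_two_mul_sub p
    filter_upwards [hz, ht.eventually hz] with s h1 h2
    rw [h1, h2, map_zero]
  | succ m ih =>
    rintro g R ⟨h, hh, hg⟩ hjet
    have hjet' : ∀ p : ℝ, p = 0 ∨ p = 1 → ∀ j < m,
        iteratedDeriv j h p = (-1 : ℝ) ^ j • (-R p) (iteratedDeriv j h p) := by
      intro p hp j hj
      have hc : Continuous h := by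
        obtain ⟨k, rfl⟩ : ∃ k, m = k + 1 := ⟨m - 1, by omega⟩
        exact (SobolevRep.regularity.2 hh).continuous
      have := hjet p hp (j + 1) (by omega)
      rw [iteratedDeriv_succ', deriv_eq_of_eq_integral hc hg] at this
      refine this.trans ?_
      rw [pow_succ, mul_neg_one, neg_smul, neg_apply, smul_neg]
    -- the derivative of a function with the symmetry `R` has the symmetry `-R`
    obtain ⟨U, hU, hUh, hUs⟩ := ih (R := fun p => -R p) hh hjet'
    obtain ⟨χ, hχ, hχ0, hχ1, hχ'⟩ := exists_smooth_step
    have hU0 := SobolevTendsto.zero_of_le hU hUh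
    have hI := tendstoUniformlyOn_integral (fun n => (hU n).continuous) hU0
    -- integrating from `0` misses the value at `1` by `κ n`; a multiple of `χ` corrects this
    set κ : ℕ → E := fun n => g 1 - (g 0 + ∫ t in (0 : ℝ)..1, U n t) with hκ
    have hκ0 : Tendsto κ atTop (𝓝 0) := by
      have h1 := (hI.tendsto_at (x := 1) (by simp)).const_add (g 0)
      rw [← hg 1] at h1
      simpa using h1.const_sub (g 1)
    have hV : ∀ n s, HasDerivAt (fun s => g 0 + ∫ t in (0 : ℝ)..s, U n t) (U n s) s := fun n s =>
      (hasDerivAt_primitive (hU n).continuous s).const_add _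
    have hV' : ∀ n, deriv (fun s => g 0 + ∫ t in (0 : ℝ)..s, U n t) = U n := fun n =>
      funext fun s => (hV n s).deriv
    have hVs : ∀ n, ContDiff ℝ ∞ (fun s => g 0 + ∫ t in (0 : ℝ)..s, U n t) := fun n =>
      contDiff_const.add (contDiff_primitive (hU n))
    have hW : ∀ n, ContDiff ℝ ∞ (fun s => χ s • κ n) := fun n => hχ.smul contDiff_const
    have hup : ∀ p : ℝ, p = 0 ∨ p = 1 → ∀ n,
        (g 0 + ∫ t in (0 : ℝ)..p, U n t) + χ p • κ n = g p := by
      rintro p (rfl | rfl) n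
      · simp [hχ0]
      · rw [hχ1, hκ]; simp
    refine ⟨fun n s => (g 0 + ∫ t in (0 : ℝ)..s, U n t) + χ s • κ n, fun n => (hVs n).add (hW n),
      ?_, fun p hp n => ⟨?_, fun _ => hup p hp n⟩⟩
    · have h1 : SobolevTendsto (m + 1) (fun n s => g 0 + ∫ t in (0 : ℝ)..s, U n t) g := by
        refine ⟨by simp, h, ?_, fun s _ => hg s⟩
        simp only [hV']
        exact hUh
      simpa using SobolevTendsto.add hVs hW h1 (sobolevTendsto_smul_const hκ0 hχ)
    · refine eventually_reflect_eq ((hVs n).add (hW n)) (U := U n) ?_ (hUs p hp n).1 ?_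
      · filter_upwards [hχ' p hp] with s hs
        rw [((hV n s).fun_add ((contDiff_infty_hasDerivAt hχ s).smul_const (κ n))).deriv, hs]
        simp
      · rw [hup p hp n]
        simpa using hjet p hp 0 (by omega)

end Approximation

/-! ### Continuous representatives of Sobolev functions -/

section Representatives

/-- Obtained by approximation with smooth functions, avoiding integration by parts for absolutely
continuous functions. -/
lemma isWeakDeriv_primitive {w : ℝ → ℝ} (hw : MemLp w 2 (volume.restrict I)) :
    IsWeakDeriv 1 (fun s => ∫ t in (0 : ℝ)..s, w t) w := by
  obtain ⟨u, hu, -, huw⟩ := exists_smooth_sobolevTendsto_zero hw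
  have hV' : ∀ n, deriv (fun s => ∫ t in (0 : ℝ)..s, u n t) = u n := fun n =>
    deriv_primitive (hu n).continuous
  have hVs : ∀ n, ContDiff ℝ ∞ (fun s => ∫ t in (0 : ℝ)..s, u n t) := fun n =>
    contDiff_primitive (hu n)
  have h1 : SobolevTendsto 1 (fun n s => ∫ t in (0 : ℝ)..s, u n t)
      (fun s => ∫ t in (0 : ℝ)..s, w t) := by
    refine ⟨by simp, w, ?_, fun s _ => by simp⟩
    simp only [hV']
    exact huw
  refine isWeakDeriv_of_tendsto hVs (SobolevTendsto.zero_of_le hVs h1) ?_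
  simp only [iteratedDeriv_one, hV']
  exact huw

lemma IsWeakDeriv.exists_ae_eq_primitive {u w : ℝ → ℝ} (h : IsWeakDeriv 1 u w)
    (hw : MemLp w 2 (volume.restrict I)) :
    ∃ c : ℝ, u =ᵐ[volume.restrict I] fun s => c + ∫ t in (0 : ℝ)..s, w t := by
  have h1 := h.sub (isWeakDeriv_primitive hw)
  obtain ⟨c, hc⟩ := exists_ae_eq_const h1.locInt fun φ hφ => by
    simpa using h1.integral_eq φ hφ
  refine ⟨c, ?_⟩
  filter_upwards [hc] with s hs
  linarith

lemma isWeakDeriv_zero {u : ℝ → ℝ} (hu : LocallyIntegrableOn u I) : IsWeakDeriv 0 u u :=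
  ⟨hu, hu, fun φ _ => by simp⟩

/-- If `w₁` is the first weak derivative of `u`, then the weak derivative of order `j + 1` of `u` is
the one of order `j` of `w₁`. -/
lemma IsWeakDeriv.of_succ {j : ℕ} {u w₁ w : ℝ → ℝ} (h₁ : IsWeakDeriv 1 u w₁)
    (h : IsWeakDeriv (j + 1) u w) : IsWeakDeriv j w₁ w := by
  refine ⟨h₁.locInt_deriv, h.locInt_deriv, fun φ hφ => ?_⟩
  have e1 := h₁.integral_eq _ (hφ.iteratedDeriv j)
  have e2 := h.integral_eq φ hφ
  rw [iteratedDeriv_one, ← iteratedDeriv_succ, e2, pow_succ] at e1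
  linarith

/-- Every element of `H^m(I)` has a representative which is an `m`-fold primitive. -/
lemma MemH.exists_sobolevRep {m : ℕ} : ∀ {u : ℝ → ℝ}, MemH m u →
    ∃ g, u =ᵐ[volume.restrict I] g ∧ SobolevRep m g := by
  induction m with
  | zero =>
    intro u hu
    obtain ⟨w, hw, hw2⟩ := hu 0 le_rfl
    refine ⟨Set.indicator I w, ?_, (memLp_indicator_iff_restrict measurableSet_Ioo).2 hw2⟩
    exact ((isWeakDeriv_zero hw.locInt).ae_eq hw (ae_eq_refl u)).trans
      (indicator_ae_eq_restrict measurableSet_Ioo).symm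
  | succ m ih =>
    intro u hu
    obtain ⟨w, hw, hw2⟩ := hu 1 (by omega)
    have hwm : MemH m w := fun j hj => by
      obtain ⟨w', h1, h2⟩ := hu (j + 1) (by omega)
      exact ⟨w', hw.of_succ h1, h2⟩
    obtain ⟨h, hwh, hh⟩ := ih hwm
    obtain ⟨c, hc⟩ := hw.exists_ae_eq_primitive hw2
    refine ⟨fun s => c + ∫ t in (0 : ℝ)..s, h t, ?_, h, hh, fun s => by simp⟩
    filter_upwards [hc, ae_restrict_mem measurableSet_Ioo] with s hs hsI
    rw [hs, intervalIntegral.integral_of_le hsI.1.le, intervalIntegral.integral_of_le hsI.1.le,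
      integral_Ioc_eq_integral_Ioo, integral_Ioc_eq_integral_Ioo]
    congr 1
    refine integral_congr_ae (ae_restrict_of_ae_restrict_of_subset ?_ hwh)
    exact Set.Ioo_subset_Ioo_right hsI.2.le

lemma sobolevRep_pi {m : ℕ} : ∀ {g : Fin 3 → ℝ → ℝ}, (∀ i, SobolevRep m (g i)) →
    SobolevRep m (fun s i => g i s) := by
  induction m with
  | zero => exact fun hg => MemLp.of_eval hg
  | succ m ih =>
    intro g hg
    choose h hh hgh using hg
    refine ⟨fun s i => h i s, ih hh, fun s => ?_⟩
    ext i
    have hi := SobolevRep.regularity.1 (ih hh) 0 s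
    have := (ContinuousLinearMap.proj (R := ℝ)
      (φ := fun _ : Fin 3 => ℝ) i).intervalIntegral_comp_comm hi
    simp only [ContinuousLinearMap.proj_apply] at this
    rw [Pi.add_apply, ← this]
    exact hgh i s

lemma MemHVec.exists_sobolevRep {m : ℕ} {v : ℝ → Fin 3 → ℝ} (hv : MemHVec m v) :
    ∃ g, v =ᵐ[volume.restrict I] g ∧ SobolevRep m g := by
  choose g hg hm using fun i => (hv i).exists_sobolevRep
  refine ⟨fun s i => g i s, ?_, sobolevRep_pi hm⟩
  filter_upwards [ae_all_iff.2 hg] with s hs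
  exact funext hs

lemma memHVec_of_contDiff {v : ℝ → Fin 3 → ℝ} (hv : ContDiff ℝ ∞ v) (m : ℕ) : MemHVec m v := by
  intro i j _
  have hi : ContDiff ℝ j (fun s => v s i) := (contDiff_pi.1 hv i).of_le (by exact_mod_cast le_top)
  exact ⟨_, isWeakDeriv_iteratedDeriv hi,
    memLp_of_continuousOn (hi.continuous_iteratedDeriv' j).continuousOn 2⟩

/-- Convergence in the sense of `SobolevTendsto` implies convergence in the norm of `H^k(I)`. -/
lemma SobolevTendsto.tendsto_normH {m k : ℕ} (hk : k ≤ m) {v : ℕ → ℝ → Fin 3 → ℝ}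
    {g v₀ : ℝ → Fin 3 → ℝ} (hv : ∀ n, ContDiff ℝ ∞ (v n)) (H : SobolevTendsto m v g)
    (hg : v₀ =ᵐ[volume.restrict I] g) :
    Tendsto (fun n => normH k (fun s => v n s - v₀ s)) atTop (𝓝 0) := by
  have key : ∀ i, ∀ j ∈ Finset.range (k + 1), Tendsto (fun n =>
      eLpNorm (weakDeriv j (fun s => (v n s - v₀ s) i)) 2 (volume.restrict I)) atTop (𝓝 0) := by
    intro i j hj
    have hvi : ∀ n, ContDiff ℝ ∞ (fun s => v n s i) := fun n => contDiff_pi.1 (hv n) i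
    have Hi : SobolevTendsto m (fun n s => v n s i) (fun s => g s i) :=
      SobolevTendsto.clm_comp (ContinuousLinearMap.proj (R := ℝ) (φ := fun _ : Fin 3 => ℝ) i) hv H
    obtain ⟨w, hw⟩ := Hi.exists_iteratedDeriv hvi j (by rw [Finset.mem_range] at hj; omega)
    have hgw := isWeakDeriv_of_tendsto hvi (SobolevTendsto.zero_of_le hvi Hi) hw
    have hvw : IsWeakDeriv j (fun s => v₀ s i) w := by
      refine hgw.congr ?_ (ae_eq_refl w)
      filter_upwards [hg] with s hs
      rw [hs]
    refine hw.2.congr fun n => (eLpNorm_congr_ae ?_).symm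
    exact ((isWeakDeriv_iteratedDeriv ((hvi n).of_le (by exact_mod_cast le_top))).sub
      hvw).weakDeriv_ae_eq
  have h1 := tendsto_finsetSum Finset.univ fun i (_ : i ∈ Finset.univ) =>
    tendsto_finsetSum (Finset.range (k + 1)) fun j hj =>
      (ENNReal.continuous_pow 2).continuousAt.tendsto.comp (key i j hj)
  have h2 := (ENNReal.continuous_rpow_const (y := (1 / 2 : ℝ))).continuousAt.tendsto.comp h1
  simpa [normH, Function.comp_def] using h2

end Representatives

/-! ### The expressions `P_m` and reflections -/

section ClassicalP

/-- The cross product as a continuous bilinear map. -/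
noncomputable def crossL : (Fin 3 → ℝ) →L[ℝ] (Fin 3 → ℝ) →L[ℝ] (Fin 3 → ℝ) :=
  (crossProduct (R := ℝ)).toContinuousBilinearMap

lemma crossL_apply (x y : Fin 3 → ℝ) : crossL x y = x ⨯₃ y := rfl

/-- The dot product as a continuous bilinear map. -/
noncomputable def dotL : (Fin 3 → ℝ) →L[ℝ] (Fin 3 → ℝ) →L[ℝ] ℝ :=
  (dotProductBilin ℝ ℝ (m := Fin 3)).toContinuousBilinearMap

lemma dotL_apply (x y : Fin 3 → ℝ) : dotL x y = x ⬝ᵥ y := rfl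

/-- The expressions `P_m(v)` with classical instead of weak derivatives, for curves defined on all
of `ℝ`. -/
noncomputable def classicalP (v : ℝ → Fin 3 → ℝ) : ℕ → ℝ → Fin 3 → ℝ
  | 0 => v
  | m + 1 => fun s => ∑ j : Fin (m + 1),
      (m.choose j : ℝ) • crossL (classicalP v j s) (deriv (deriv (classicalP v (m - j))) s)
  termination_by m => m
  decreasing_by all_goals omega

lemma classicalP_zero (v : ℝ → Fin 3 → ℝ) : classicalP v 0 = v := by rw [classicalP]

lemma classicalP_succ (v : ℝ → Fin 3 → ℝ) (m : ℕ) : classicalP v (m + 1) = fun s =>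
    ∑ j : Fin (m + 1), (m.choose j : ℝ) •
      crossL (classicalP v j s) (deriv (deriv (classicalP v (m - j))) s) := by
  rw [classicalP]

lemma contDiff_deriv_deriv {E : Type*} [NormedAddCommGroup E] [NormedSpace ℝ E] {n : ℕ}
    {f : ℝ → E} (hf : ContDiff ℝ (n + 2 : ℕ) f) : ContDiff ℝ n (deriv (deriv f)) := by
  have h1 : ContDiff ℝ (n + 1 : ℕ) (deriv f) := by
    have := (contDiff_succ_iff_deriv (n := ((n + 1 : ℕ) : WithTop ℕ∞)) (f := f)).1
      (by exact_mod_cast hf)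
    exact this.2.2
  exact ((contDiff_succ_iff_deriv (n := ((n : ℕ) : WithTop ℕ∞)) (f := deriv f)).1
      (by exact_mod_cast h1)).2.2

lemma contDiff_classicalP {v : ℝ → Fin 3 → ℝ} (m : ℕ) : ∀ {n : ℕ},
    ContDiff ℝ (n + 2 * m : ℕ) v → ContDiff ℝ n (classicalP v m) := by
  induction m using Nat.strong_induction_on with
  | _ m ih =>
    intro n hv
    rcases m with _ | m
    · simpa [classicalP_zero] using hv
    · rw [classicalP_succ]
      refine ContDiff.sum fun j _ => ?_
      have h1 : ContDiff ℝ n (classicalP v j) :=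
        ih j (by omega) (hv.of_le (by exact_mod_cast (by omega)))
      have h2 : ContDiff ℝ (n + 2 : ℕ) (classicalP v (m - j)) :=
        ih (m - j) (by omega) (hv.of_le (by exact_mod_cast (by omega)))
      have h3 := contDiff_bilinear crossL h1 (contDiff_deriv_deriv h2)
      exact (contDiff_const (c := (m.choose j : ℝ))).smul h3

lemma contDiff_classicalP_infty {v : ℝ → Fin 3 → ℝ} (hv : ContDiff ℝ ∞ v) (m : ℕ) :
    ContDiff ℝ ∞ (classicalP v m) :=
  contDiff_infty.2 fun _ => contDiff_classicalP m (contDiff_infty.1 hv _)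

lemma deriv_apply_pi {f : ℝ → Fin 3 → ℝ} (hf : Differentiable ℝ f) (i : Fin 3) :
    deriv (fun s => f s i) = fun s => deriv f s i :=
  funext fun s => ((hasDerivAt_pi.1 (hf s).hasDerivAt) i).deriv

lemma weakDeriv2_ae_eq {u f : ℝ → Fin 3 → ℝ} (h : u =ᵐ[volume.restrict I] f)
    (hf : ContDiff ℝ (2 : ℕ) f) : weakDeriv2 u =ᵐ[volume.restrict I] deriv (deriv f) := by
  have h1 : ∀ i, weakDeriv 2 (fun s => u s i) =ᵐ[volume.restrict I]
      iteratedDeriv 2 (fun s => f s i) := fun i => by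
    have hi := isWeakDeriv_iteratedDeriv (j := 2) (contDiff_pi.1 hf i)
    refine (hi.congr ?_ (ae_eq_refl _)).weakDeriv_ae_eq
    filter_upwards [h] with s hs
    rw [hs]
  have hd : Differentiable ℝ f := hf.differentiable (by norm_num)
  have hd2 : Differentiable ℝ (deriv f) := by
    have : ContDiff ℝ (1 + 1 : ℕ) f := hf
    exact (contDiff_succ_iff_deriv.1 (by exact_mod_cast this)).2.2.differentiable one_ne_zero
  filter_upwards [ae_all_iff.2 h1] with s hs
  ext i
  rw [weakDeriv2, hs i, iteratedDeriv_succ, iteratedDeriv_one, deriv_apply_pi hd,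
    deriv_apply_pi hd2]

/-- If `u` has a representative of class `C^{2m}`, then `P_m(u)` is represented by the classical
expression. -/
lemma P_ae_eq_classicalP {u v : ℝ → Fin 3 → ℝ} (h : u =ᵐ[volume.restrict I] v) (m : ℕ) :
    ContDiff ℝ (2 * m : ℕ) v → P u m =ᵐ[volume.restrict I] classicalP v m := by
  induction m using Nat.strong_induction_on with
  | _ m ih =>
    intro hv
    rcases m with _ | m
    · rw [classicalP_zero, P]
      exact h
    · have h1 : ∀ j : Fin (m + 1), P u j =ᵐ[volume.restrict I] classicalP v j := fun j =>
        ih j (by omega) (hv.of_le (by exact_mod_cast (by omega)))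
      have h2 : ∀ j : Fin (m + 1), weakDeriv2 (P u (m - j)) =ᵐ[volume.restrict I]
          deriv (deriv (classicalP v (m - j))) := fun j =>
        weakDeriv2_ae_eq (ih (m - j) (by omega) (hv.of_le (by exact_mod_cast (by omega))))
          (contDiff_classicalP _ (hv.of_le (by exact_mod_cast (by omega))))
      rw [classicalP_succ, P]
      filter_upwards [ae_all_iff.2 h1, ae_all_iff.2 h2] with s hs1 hs2
      refine Finset.sum_congr rfl fun j _ => ?_
      rw [hs1 j, hs2 j, crossL_apply]

lemma classicalP_eventuallyEq {u v : ℝ → Fin 3 → ℝ} {p : ℝ} (h : u =ᶠ[𝓝 p] v) (m : ℕ) :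
    classicalP u m =ᶠ[𝓝 p] classicalP v m := by
  induction m using Nat.strong_induction_on with
  | _ m ih =>
    rcases m with _ | m
    · simpa only [classicalP_zero] using h
    · have h1 : ∀ j : Fin (m + 1), classicalP u j =ᶠ[𝓝 p] classicalP v j := fun j =>
        ih j (by omega)
      have h2 : ∀ j : Fin (m + 1), deriv (deriv (classicalP u (m - j))) =ᶠ[𝓝 p]
          deriv (deriv (classicalP v (m - j))) := fun j => (ih (m - j) (by omega)).deriv.deriv
      rw [classicalP_succ, classicalP_succ]
      filter_upwards [eventually_all.2 h1, eventually_all.2 h2] with s hs1 hs2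
      refine Finset.sum_congr rfl fun j _ => ?_
      rw [hs1 j, hs2 j]

/-- The rotation by the angle `π` about the axis spanned by the unit vector `b`, that is,
`x ↦ 2 ⟨b, x⟩ b - x`. -/
noncomputable def halfTurn (b : Fin 3 → ℝ) : (Fin 3 → ℝ) →L[ℝ] (Fin 3 → ℝ) :=
  (2 : ℝ) • (dotL b).smulRight b - ContinuousLinearMap.id ℝ (Fin 3 → ℝ)

lemma halfTurn_apply (b x : Fin 3 → ℝ) : halfTurn b x = (2 * (b ⬝ᵥ x)) • b - x := by
  simp [halfTurn, dotL_apply, mul_smul]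

lemma halfTurn_self {b : Fin 3 → ℝ} (hb : b ⬝ᵥ b = 1) : halfTurn b b = b := by
  rw [halfTurn_apply, hb, mul_one, two_smul, add_sub_cancel_right]

lemma halfTurn_halfTurn {b : Fin 3 → ℝ} (hb : b ⬝ᵥ b = 1) (x : Fin 3 → ℝ) :
    halfTurn b (halfTurn b x) = x := by
  rw [halfTurn_apply, halfTurn_apply, dotProduct_sub, dotProduct_smul, hb, smul_eq_mul, mul_one]
  module

/-- Rotations preserve the cross product; the proof uses that `b` is a unit vector. -/
lemma halfTurn_cross {b : Fin 3 → ℝ} (hb : b ⬝ᵥ b = 1) (x y : Fin 3 → ℝ) :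
    crossL (halfTurn b x) (halfTurn b y) = halfTurn b (crossL x y) := by
  simp only [halfTurn_apply, crossL_apply]
  simp only [dotProduct, Fin.sum_univ_three] at hb
  ext i
  fin_cases i <;>
    simp [cross_apply, dotProduct, Fin.sum_univ_three]
  · linear_combination (-2 * (x 1 * y 2 - x 2 * y 1)) * hb
  · linear_combination (-2 * (x 2 * y 0 - x 0 * y 2)) * hb
  · linear_combination (-2 * (x 0 * y 1 - x 1 * y 0)) * hb

lemma halfTurn_dot {b : Fin 3 → ℝ} (hb : b ⬝ᵥ b = 1) (x y : Fin 3 → ℝ) :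
    halfTurn b x ⬝ᵥ halfTurn b y = x ⬝ᵥ y := by
  simp only [halfTurn_apply]
  simp only [dotProduct, Fin.sum_univ_three] at hb ⊢
  simp
  linear_combination (4 * (b 0 * x 0 + b 1 * x 1 + b 2 * x 2) *
    (b 0 * y 0 + b 1 * y 1 + b 2 * y 2)) * hb

/-- The reflection of a curve: parameter reflected in `p`, values rotated about the axis `b`. -/
noncomputable def reflect (b : Fin 3 → ℝ) (p : ℝ) (v : ℝ → Fin 3 → ℝ) : ℝ → Fin 3 → ℝ :=
  fun s => halfTurn b (v (2 * p - s))

lemma contDiff_reflect {b : Fin 3 → ℝ} {p : ℝ} {n : WithTop ℕ∞} {v : ℝ → Fin 3 → ℝ}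
    (hv : ContDiff ℝ n v) : ContDiff ℝ n (reflect b p v) :=
  (halfTurn b).contDiff.comp (hv.comp (contDiff_const.sub contDiff_id))

lemma deriv_reflect {b : Fin 3 → ℝ} {p : ℝ} {v : ℝ → Fin 3 → ℝ} (hv : Differentiable ℝ v) :
    deriv (reflect b p v) = fun s => -reflect b p (deriv v) s := by
  ext1 s
  have h1 := (hv (2 * p - s)).hasDerivAt.scomp s ((hasDerivAt_id s).const_sub (2 * p))
  have h2 := (halfTurn b).hasFDerivAt.comp_hasDerivAt s h1
  have h3 : HasDerivAt (fun s => halfTurn b (v (2 * p - s)))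
      (-halfTurn b (deriv v (2 * p - s))) s := by
    simpa [Function.comp_def] using h2
  exact h3.deriv

lemma deriv_deriv_reflect {b : Fin 3 → ℝ} {p : ℝ} {v : ℝ → Fin 3 → ℝ}
    (hv : ContDiff ℝ (2 : ℕ) v) :
    deriv (deriv (reflect b p v)) = reflect b p (deriv (deriv v)) := by
  have hd : Differentiable ℝ v := hv.differentiable (by norm_num)
  have hd2 : Differentiable ℝ (deriv v) := by
    have : ContDiff ℝ (1 + 1 : ℕ) v := hv
    exact (contDiff_succ_iff_deriv.1 (by exact_mod_cast this)).2.2.differentiable one_ne_zero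
  rw [deriv_reflect hd]
  ext1 s
  rw [deriv.fun_neg, deriv_reflect hd2, neg_neg]

lemma iteratedDeriv_reflect {b : Fin 3 → ℝ} {p : ℝ} {N : ℕ} : ∀ {v : ℝ → Fin 3 → ℝ},
    ContDiff ℝ N v → iteratedDeriv N (reflect b p v) p =
      (-1 : ℝ) ^ N • halfTurn b (iteratedDeriv N v p) := by
  induction N with
  | zero => intro v _; simp [reflect, two_mul]
  | succ N ih =>
    intro v hv
    have hv' := contDiff_succ_iff_deriv.1
      (show ContDiff ℝ ((N : WithTop ℕ∞) + 1) v by exact_mod_cast hv)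
    rw [iteratedDeriv_succ', deriv_reflect hv'.1, iteratedDeriv_fun_neg, ih hv'.2.2,
      iteratedDeriv_succ', pow_succ, mul_neg_one, neg_smul]

/-- `P_m` commutes with reflections, since rotations preserve the cross product. -/
lemma classicalP_reflect {b : Fin 3 → ℝ} (hb : b ⬝ᵥ b = 1) {p : ℝ} {v : ℝ → Fin 3 → ℝ} (m : ℕ) :
    ContDiff ℝ (2 * m : ℕ) v → classicalP (reflect b p v) m = reflect b p (classicalP v m) := by
  induction m using Nat.strong_induction_on with
  | _ m ih =>
    intro hv
    rcases m with _ | m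
    · rw [classicalP_zero, classicalP_zero]
    · rw [classicalP_succ, classicalP_succ]
      ext1 s
      rw [reflect, map_sum]
      refine Finset.sum_congr rfl fun j _ => ?_
      rw [ih j (by omega) (hv.of_le (by exact_mod_cast (by omega))),
        ih (m - j) (by omega) (hv.of_le (by exact_mod_cast (by omega))),
        deriv_deriv_reflect (contDiff_classicalP _ (hv.of_le (by exact_mod_cast (by omega)))),
        map_smul, ← halfTurn_cross hb]
      rfl

/-- For a curve which is symmetric near `p`, all `P_m`, `m ≥ 1`, vanish at `p`: they are sums of
cross products of vectors on the axis. -/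
lemma classicalP_eq_zero_of_symmetric {b : Fin 3 → ℝ} (hb : b ⬝ᵥ b = 1) {p : ℝ}
    {v : ℝ → Fin 3 → ℝ} (hv : ContDiff ℝ ∞ v)
    (hs : ∀ᶠ s in 𝓝 p, v (2 * p - s) = halfTurn b (v s)) {m : ℕ} (hm : 1 ≤ m) :
    classicalP v m p = 0 := by
  have h0 : reflect b p v =ᶠ[𝓝 p] v := by
    filter_upwards [hs] with s hs
    rw [reflect, hs, halfTurn_halfTurn hb]
  have hfin : ∀ n : ℕ, ContDiff ℝ n v := contDiff_infty.1 hv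
  have h1 : ∀ k, reflect b p (classicalP v k) =ᶠ[𝓝 p] classicalP v k := fun k => by
    rw [← classicalP_reflect hb k (hfin _)]
    exact classicalP_eventuallyEq h0 k
  have hfix : ∀ x, halfTurn b x = x → x = (b ⬝ᵥ x) • b := fun x hx => by
    rw [halfTurn_apply, sub_eq_iff_eq_add, ← two_smul ℝ x, mul_smul] at hx
    exact (smul_right_injective _ (two_ne_zero (α := ℝ)) hx).symm
  have h2 : ∀ k, ∃ c : ℝ, classicalP v k p = c • b := fun k => by
    refine ⟨_, hfix _ ?_⟩
    simpa [reflect, two_mul] using (h1 k).eq_of_nhds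
  have h3 : ∀ k, ∃ c : ℝ, deriv (deriv (classicalP v k)) p = c • b := fun k => by
    refine ⟨_, hfix _ ?_⟩
    have := (h1 k).deriv.deriv.eq_of_nhds
    rw [deriv_deriv_reflect (contDiff_classicalP k (hfin _))] at this
    simpa [reflect, two_mul] using this
  obtain ⟨m, rfl⟩ : ∃ k, m = k + 1 := ⟨m - 1, by omega⟩
  rw [classicalP_succ]
  refine Finset.sum_eq_zero fun j _ => ?_
  obtain ⟨c, hc⟩ := h2 j
  obtain ⟨d, hd⟩ := h3 (m - j)
  rw [hc, hd, crossL_apply]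
  simp

end ClassicalP

/-! ### Leading derivatives at a point -/

section Jets

variable {E F G : Type*} [NormedAddCommGroup E] [NormedSpace ℝ E]
  [NormedAddCommGroup F] [NormedSpace ℝ F] [NormedAddCommGroup G] [NormedSpace ℝ G]

/-- The derivatives at `p` of order less than `N` of `d` vanish, and the one of order `N` is `c`. -/
def LeadingJet (p : ℝ) (N : ℕ) (c : E) (d : ℝ → E) : Prop :=
  (∀ j < N, iteratedDeriv j d p = 0) ∧ iteratedDeriv N d p = c

lemma leadingJet_zero {p : ℝ} {c : E} {d : ℝ → E} : LeadingJet p 0 c d ↔ d p = c := by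
  simp [LeadingJet]

lemma leadingJet_succ {p : ℝ} {N : ℕ} {c : E} {d : ℝ → E} :
    LeadingJet p (N + 1) c d ↔ d p = 0 ∧ LeadingJet p N c (deriv d) := by
  simp only [LeadingJet, iteratedDeriv_succ']
  constructor
  · rintro ⟨h1, h2⟩
    exact ⟨by simpa using h1 0 (by omega),
      fun j hj => by simpa [iteratedDeriv_succ'] using h1 (j + 1) (by omega), h2⟩
  · rintro ⟨h0, h1, h2⟩
    refine ⟨fun j hj => ?_, h2⟩
    rcases j with _ | j
    · simpa using h0
    · rw [iteratedDeriv_succ']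
      exact h1 j (by omega)

lemma LeadingJet.of_lt {p : ℝ} {N k : ℕ} {c : E} {d : ℝ → E} (h : LeadingJet p N c d)
    (hk : k < N) : LeadingJet p k 0 d :=
  ⟨fun j hj => h.1 j (hj.trans hk), h.1 k hk⟩

lemma LeadingJet.add {p : ℝ} {N : ℕ} {c c' : E} {d d' : ℝ → E} (h : LeadingJet p N c d)
    (h' : LeadingJet p N c' d') (hd : ContDiff ℝ N d) (hd' : ContDiff ℝ N d') :
    LeadingJet p N (c + c') (fun s => d s + d' s) := by
  have key : ∀ j ≤ N, iteratedDeriv j (fun s => d s + d' s) p =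
      iteratedDeriv j d p + iteratedDeriv j d' p := fun j hj =>
    iteratedDeriv_add (hd.of_le (by exact_mod_cast hj)).contDiffAt
      (hd'.of_le (by exact_mod_cast hj)).contDiffAt
  exact ⟨fun j hj => by rw [key j hj.le, h.1 j hj, h'.1 j hj, add_zero],
    by rw [key N le_rfl, h.2, h'.2]⟩

lemma LeadingJet.sum {ι : Type*} {s : Finset ι} {p : ℝ} {N : ℕ} {c : ι → E} {d : ι → ℝ → E}
    (h : ∀ i ∈ s, LeadingJet p N (c i) (d i)) (hd : ∀ i ∈ s, ContDiff ℝ N (d i)) :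
    LeadingJet p N (∑ i ∈ s, c i) (fun t => ∑ i ∈ s, d i t) := by
  have key : ∀ j ≤ N, iteratedDeriv j (fun t => ∑ i ∈ s, d i t) p =
      ∑ i ∈ s, iteratedDeriv j (d i) p := fun j hj =>
    iteratedDeriv_fun_sum fun i hi => ((hd i hi).of_le (by exact_mod_cast hj)).contDiffAt
  exact ⟨fun j hj => by rw [key j hj.le]; exact Finset.sum_eq_zero fun i hi => (h i hi).1 j hj,
    by rw [key N le_rfl]; exact Finset.sum_congr rfl fun i hi => (h i hi).2⟩

lemma LeadingJet.const_smul {p : ℝ} {N : ℕ} {c : E} {d : ℝ → E} (h : LeadingJet p N c d) (r : ℝ) :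
    LeadingJet p N (r • c) (fun s => r • d s) :=
  ⟨fun j hj => by rw [iteratedDeriv_fun_const_smul_field, h.1 j hj, smul_zero],
    by rw [iteratedDeriv_fun_const_smul_field, h.2]⟩

lemma LeadingJet.bilinear (B : E →L[ℝ] F →L[ℝ] G) {p : ℝ} {N : ℕ} : ∀ {c : E} {d : ℝ → E}
    {h : ℝ → F}, LeadingJet p N c d → ContDiff ℝ N d → ContDiff ℝ N h →
      LeadingJet p N (B c (h p)) (fun s => B (d s) (h s)) := by
  induction N with
  | zero =>
    intro c d h hd _ _
    rw [leadingJet_zero] at hd ⊢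
    rw [hd]
  | succ N ih =>
    intro c d h hd hds hhs
    have hd' := contDiff_succ_iff_deriv.1
      (show ContDiff ℝ ((N : WithTop ℕ∞) + 1) d by exact_mod_cast hds)
    have hh' := contDiff_succ_iff_deriv.1
      (show ContDiff ℝ ((N : WithTop ℕ∞) + 1) h by exact_mod_cast hhs)
    have hdN := hds.of_le (show ((N : ℕ) : WithTop ℕ∞) ≤ (N + 1 : ℕ) by exact_mod_cast N.le_succ)
    have hhN := hhs.of_le (show ((N : ℕ) : WithTop ℕ∞) ≤ (N + 1 : ℕ) by exact_mod_cast N.le_succ)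
    have hder : deriv (fun s => B (d s) (h s)) =
        fun s => B (d s) (deriv h s) + B (deriv d s) (h s) := funext fun s =>
      (B.hasDerivAt_of_bilinear (fun _ => (hd'.1 s).hasDerivAt)
        (fun _ => (hh'.1 s).hasDerivAt)).deriv
    have h1 := ih (hd.of_lt N.lt_succ_self) hdN hh'.2.2
    rw [leadingJet_succ] at hd ⊢
    refine ⟨by rw [hd.1]; simp, ?_⟩
    rw [hder]
    simpa using h1.add (ih hd.2 hd'.2.2 hhN) (contDiff_bilinear B hdN hh'.2.2)
      (contDiff_bilinear B hd'.2.2 hhN)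

lemma LeadingJet.bilinear_sub (B : E →L[ℝ] F →L[ℝ] G) {p : ℝ} {N : ℕ} {c : E} {c' : F}
    {f g : ℝ → E} {h k : ℝ → F} (hfg : LeadingJet p N c (fun s => f s - g s))
    (hhk : LeadingJet p N c' (fun s => h s - k s)) (hf : ContDiff ℝ N f) (hg : ContDiff ℝ N g)
    (hh : ContDiff ℝ N h) (hk : ContDiff ℝ N k) :
    LeadingJet p N (B c (h p) + B (g p) c') (fun s => B (f s) (h s) - B (g s) (k s)) := by
  have h1 := hfg.bilinear B (hf.sub hg) hh
  have h2 := hhk.bilinear B.flip (hh.sub hk) hg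
  have := h1.add h2 (contDiff_bilinear B (hf.sub hg) hh)
    (contDiff_bilinear B.flip (hh.sub hk) hg)
  have e : ∀ s, B (f s) (h s) - B (g s) (k s) =
      B (f s - g s) (h s) + B.flip (h s - k s) (g s) := fun s => by
    rw [B.flip_apply, map_sub, map_sub, sub_apply]
    abel
  simp only [e]
  exact this

end Jets

/-! ### Compatibility conditions and symmetry -/

section Compatibility

lemma LeadingJet.deriv_deriv_sub {E : Type*} [NormedAddCommGroup E] [NormedSpace ℝ E] {p : ℝ}
    {k : ℕ} {c : E} {f g : ℝ → E} (h : LeadingJet p (k + 2) c (fun s => f s - g s))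
    (hf : ContDiff ℝ (k + 2 : ℕ) f) (hg : ContDiff ℝ (k + 2 : ℕ) g) :
    LeadingJet p k c (fun s => deriv (deriv f) s - deriv (deriv g) s) := by
  have e : ∀ {n : ℕ} {f g : ℝ → E}, ContDiff ℝ (n + 1 : ℕ) f → ContDiff ℝ (n + 1 : ℕ) g →
      deriv (fun s => f s - g s) = fun s => deriv f s - deriv g s := fun {n f g} hf hg =>
    funext fun s =>
      deriv_fun_sub ((hf.differentiable (by simp)) s) ((hg.differentiable (by simp)) s)
  have d : ∀ {f : ℝ → E}, ContDiff ℝ (k + 2 : ℕ) f → ContDiff ℝ (k + 1 : ℕ) (deriv f) :=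
    fun {f} hf => (contDiff_succ_iff_deriv (n := ((k + 1 : ℕ) : WithTop ℕ∞)).1
      (by exact_mod_cast hf)).2.2
  have h1 := (leadingJet_succ.1 h).2
  rw [e hf hg] at h1
  have h2 := (leadingJet_succ.1 h1).2
  rwa [e (d hf) (d hg)] at h2

/-- The leading term of `P_m(v)` is `(v ×)^m ∂^{2m} v`: if the derivatives of `v` and `w` at `p`
agree below the order `k + 2m` and differ by `c` at this order, then those of `P_m(v)` and `P_m(w)`
agree below the order `k` and differ by `(w(p) ×)^m c` at this order. -/
lemma leadingJet_classicalP {p : ℝ} {v w : ℝ → Fin 3 → ℝ} {c : Fin 3 → ℝ} (m : ℕ) : ∀ {k : ℕ},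
    ContDiff ℝ (k + 2 * m : ℕ) v → ContDiff ℝ (k + 2 * m : ℕ) w →
    LeadingJet p (k + 2 * m) c (fun s => v s - w s) →
    LeadingJet p k ((crossL (w p))^[m] c) (fun s => classicalP v m s - classicalP w m s) := by
  induction m using Nat.strong_induction_on with
  | _ m ih =>
    intro k hv hw h
    rcases m with _ | m
    · simpa [classicalP_zero] using h
    have cv : ∀ {n i : ℕ}, n + 2 * i ≤ k + 2 * (m + 1) → ContDiff ℝ n (classicalP v i) :=
      fun {n i} hn => contDiff_classicalP i (hv.of_le (by exact_mod_cast hn))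
    have cw : ∀ {n i : ℕ}, n + 2 * i ≤ k + 2 * (m + 1) → ContDiff ℝ n (classicalP w i) :=
      fun {n i} hn => contDiff_classicalP i (hw.of_le (by exact_mod_cast hn))
    -- among the products in `P_{m+1}`, only `v × ∂² P_m(v)` contributes at the order `k`
    have hP : ∀ j ≤ m, LeadingJet p k 0 (fun s => classicalP v j s - classicalP w j s) := by
      intro j hj
      have e : k + 2 * (m + 1) = (k + 2 * (m + 1 - j)) + 2 * j := by omega
      rw [e] at hv hw h
      exact (ih j (by omega) hv hw h).of_lt (by omega)
    have hQ : ∀ j ≤ m, LeadingJet p k (if j = 0 then (crossL (w p))^[m] c else 0)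
        (fun s => deriv (deriv (classicalP v (m - j))) s -
          deriv (deriv (classicalP w (m - j))) s) := by
      intro j hj
      have e : k + 2 * (m + 1) = (k + 2 + 2 * j) + 2 * (m - j) := by omega
      refine LeadingJet.deriv_deriv_sub ?_ (cv (by omega)) (cw (by omega))
      rw [e] at hv hw h
      have h1 := ih (m - j) (by omega) hv hw h
      rcases Nat.eq_zero_or_pos j with rfl | hj0
      · simpa using h1
      · rw [if_neg hj0.ne']
        exact h1.of_lt (by omega)
    have hterm : ∀ j ∈ (Finset.univ : Finset (Fin (m + 1))), LeadingJet p k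
        ((m.choose j : ℝ) • crossL (w p) (if (j : ℕ) = 0 then (crossL (w p))^[m] c else 0))
        (fun s => (m.choose j : ℝ) •
          (crossL (classicalP v j s) (deriv (deriv (classicalP v (m - j))) s) -
            crossL (classicalP w j s) (deriv (deriv (classicalP w (m - j))) s))) := by
      intro j _
      refine LeadingJet.const_smul ?_ _
      have := LeadingJet.bilinear_sub crossL (hP j (by omega)) (hQ j (by omega))
        (cv (by omega)) (cw (by omega))
        (contDiff_deriv_deriv (cv (by omega))) (contDiff_deriv_deriv (cw (by omega)))
      by_cases hj : (j : ℕ) = 0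
      · simpa [hj, classicalP_zero] using this
      · simpa [hj] using this
    have hsum := LeadingJet.sum hterm fun j _ => by
      have h1 := (contDiff_bilinear crossL (cv (n := k) (i := j) (by omega))
        (contDiff_deriv_deriv (cv (n := k + 2) (i := m - j) (by omega)))).sub
        (contDiff_bilinear crossL (cw (n := k) (i := j) (by omega))
        (contDiff_deriv_deriv (cw (n := k + 2) (i := m - j) (by omega))))
      exact (contDiff_const (c := (m.choose j : ℝ))).smul h1
    rw [classicalP_succ, classicalP_succ, Function.iterate_succ_apply']
    simp only [smul_sub, Finset.sum_sub_distrib] at hsum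
    convert hsum using 1
    rw [Fin.sum_univ_succ]
    simp

/-- On the plane orthogonal to the unit vector `b`, the map `b ×` is a rotation by a right angle,
hence injective. -/
lemma eq_zero_of_iterate_cross_eq_zero {b : Fin 3 → ℝ} (hb : b ⬝ᵥ b = 1) (m : ℕ) :
    ∀ {x : Fin 3 → ℝ}, b ⬝ᵥ x = 0 → (crossL b)^[m] x = 0 → x = 0 := by
  induction m with
  | zero => intro x _ h; simpa using h
  | succ m ih =>
    intro x hx h
    rw [Function.iterate_succ_apply] at h
    have h1 : crossL b x = 0 := ih (by rw [crossL_apply, dot_self_cross]) h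
    have h2 : crossL b (crossL b x) = -x := by
      rw [crossL_apply, crossL_apply, cross_cross_eq_smul_sub_smul', hx, hb]
      simp
    rw [h1, map_zero] at h2
    exact neg_eq_zero.1 h2.symm

/-- Only one-sided information is available at the endpoints; the derivatives there are limits of
those in the interior. -/
lemma iteratedDeriv_eq_zero_of_eqOn_const {h : ℝ → ℝ} {c : ℝ} {N : ℕ} (hN : N ≠ 0)
    (hh : ContDiff ℝ N h) (hc : ∀ s ∈ Set.Icc (0 : ℝ) 1, h s = c) {p : ℝ}
    (hp : p ∈ Set.Icc (0 : ℝ) 1) : iteratedDeriv N h p = 0 := by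
  have h1 : Set.EqOn (iteratedDeriv N h) (fun _ => 0) (Set.Ioo 0 1) := fun s hs => by
    have : h =ᶠ[𝓝 s] fun _ => c := by
      filter_upwards [isOpen_Ioo.mem_nhds hs] with t ht using hc t (Set.Ioo_subset_Icc_self ht)
    rw [this.iteratedDeriv_eq, iteratedDeriv_const, if_neg hN]
  have h2 := h1.closure (hh.continuous_iteratedDeriv' N) continuous_const
  rw [closure_Ioo zero_ne_one] at h2
  exact h2 hp

/-- The compatibility conditions `P_m(g) = 0` at an endpoint `p`, `1 ≤ m ≤ K`, for a curve on the
sphere, force the derivatives of `g` at `p` up to the order `2K` to be those of a curve which is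
symmetric with respect to the reflection. -/
theorem iteratedDeriv_eq_halfTurn {K : ℕ} {g : ℝ → Fin 3 → ℝ} {b : Fin 3 → ℝ} {p : ℝ}
    (hb : b ⬝ᵥ b = 1) (hg : ContDiff ℝ (2 * K : ℕ) g)
    (hunit : ∀ s ∈ Set.Icc (0 : ℝ) 1, g s ⬝ᵥ g s = 1) (hp : p ∈ Set.Icc (0 : ℝ) 1) (hgp : g p = b)
    (hP : ∀ m, 1 ≤ m → m ≤ K → classicalP g m p = 0) :
    ∀ N ≤ 2 * K, iteratedDeriv N g p = (-1 : ℝ) ^ N • halfTurn b (iteratedDeriv N g p) := by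
  set S := reflect b p g with hS
  have hSg : ContDiff ℝ (2 * K : ℕ) S := contDiff_reflect hg
  have hSp : S p = b := by
    rw [hS, reflect, two_mul, add_sub_cancel_right, hgp, halfTurn_self hb]
  have hd : ∀ N ≤ 2 * K, iteratedDeriv N (fun s => g s - S s) p =
      iteratedDeriv N g p - (-1 : ℝ) ^ N • halfTurn b (iteratedDeriv N g p) := fun N hN => by
    have h1 : ContDiff ℝ N g := hg.of_le (by exact_mod_cast hN)
    have h2 : ContDiff ℝ N S := hSg.of_le (by exact_mod_cast hN)
    rw [← iteratedDeriv_reflect h1]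
    exact iteratedDeriv_sub h1.contDiffAt h2.contDiffAt
  suffices h : ∀ N ≤ 2 * K, iteratedDeriv N (fun s => g s - S s) p = 0 from fun N hN =>
    sub_eq_zero.1 ((hd N hN).symm.trans (h N hN))
  intro N
  induction N using Nat.strong_induction_on with
  | _ N ih =>
    intro hN
    set x := iteratedDeriv N g p with hx
    set c := iteratedDeriv N (fun s => g s - S s) p with hc
    have hlead : LeadingJet p N c (fun s => g s - S s) :=
      ⟨fun j hj => ih j hj (by omega), rfl⟩
    have hgN : ContDiff ℝ N g := hg.of_le (by exact_mod_cast hN)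
    have hSN : ContDiff ℝ N S := hSg.of_le (by exact_mod_cast hN)
    have hcx := hd N hN
    rw [← hc, ← hx, halfTurn_apply] at hcx
    rcases Nat.even_or_odd' N with ⟨k, hk | hk⟩
    · rcases Nat.eq_zero_or_pos k with rfl | hk0
      · rw [hc, hk, mul_zero, iteratedDeriv_zero, hgp, hSp, sub_self]
      · -- even order: `c` is orthogonal to `b`, and `P_k(g) - P_k(S)` equals `(b ×)^k c` at `p`
        subst hk
        rw [pow_mul, neg_one_sq, one_pow, one_smul] at hcx
        have h1 := leadingJet_classicalP (p := p) (v := g) (w := S) (c := c) k (k := 0)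
          (by simpa using hgN) (by simpa using hSN) (by simpa using hlead)
        rw [leadingJet_zero, hSp, hS, classicalP_reflect hb k hgN, reflect, two_mul,
          add_sub_cancel_right, hP k hk0 (by omega), map_zero, sub_self] at h1
        refine eq_zero_of_iterate_cross_eq_zero hb k ?_ h1.symm
        rw [hcx, dotProduct_sub, dotProduct_sub, dotProduct_smul, hb, smul_eq_mul]
        ring
    · -- odd order: `c` is parallel to `b`, and differentiating `⟨g, g⟩ = 1` gives `⟨b, c⟩ = 0`
      rw [hk, pow_succ, pow_mul, neg_one_sq, one_pow, one_mul, neg_one_smul] at hcx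
      have h1 := (LeadingJet.bilinear_sub dotL hlead hlead hgN hSN hgN hSN).2
      have hdot : ContDiff ℝ N (fun s => dotL (g s) (g s)) := contDiff_bilinear dotL hgN hgN
      have hN0 : N ≠ 0 := by omega
      have h2 : iteratedDeriv N (fun s => dotL (g s) (g s)) p = 0 :=
        iteratedDeriv_eq_zero_of_eqOn_const hN0 hdot hunit hp
      have h3 : iteratedDeriv N (fun s => dotL (S s) (S s)) p = 0 := by
        have e : (fun s => dotL (S s) (S s)) =
            fun s => (fun s => dotL (g s) (g s)) (2 * p - s) := by
          ext s
          simp only [hS, reflect, dotL_apply, halfTurn_dot hb]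
        have h4 := congrFun (iteratedDeriv_comp_const_sub (n := N)
          (f := fun s => dotL (g s) (g s)) (s := 2 * p)) p
        rw [e, h4]
        simp [two_mul, h2]
      have h4 : iteratedDeriv N (fun s => dotL (g s) (g s) - dotL (S s) (S s)) p = 0 := by
        have := iteratedDeriv_sub (n := N) (x := p) hdot.contDiffAt
          (contDiff_bilinear dotL hSN hSN).contDiffAt
        rw [h2, h3, sub_zero] at this
        exact this
      rw [h4, hgp, hSp, dotL_apply, dotL_apply, dotProduct_comm c b] at h1
      have h5 : b ⬝ᵥ c = 0 := by linarith
      have h6 : c = (2 * (b ⬝ᵥ x)) • b := by rw [hcx]; simp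
      rw [h6, dotProduct_smul, hb, smul_eq_mul, mul_one] at h5
      rw [h6, h5, zero_smul]

/-- A smooth function which equals `r ↦ r ^ (-1/2)` on `[1/4, ∞)`. -/
lemma exists_smooth_inv_sqrt : ∃ φ : ℝ → ℝ, ContDiff ℝ ∞ φ ∧ ∀ r, 1 / 4 ≤ r → φ r = (√r)⁻¹ := by
  refine ⟨fun r => Real.smoothTransition (8 * r - 1) * (√r)⁻¹, ?_, fun r hr => ?_⟩
  · rw [contDiff_iff_contDiffAt]
    intro r
    rcases lt_or_ge r (1 / 8) with h | h
    · refine (contDiffAt_const (c := (0 : ℝ))).congr_of_eventuallyEq ?_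
      filter_upwards [gt_mem_nhds h] with t ht
      rw [Real.smoothTransition.zero_of_nonpos (by linarith), zero_mul]
    · have hr : (0 : ℝ) < r := by linarith
      refine ContDiffAt.mul (Real.smoothTransition.contDiff.comp (by fun_prop)).contDiffAt ?_
      exact (Real.contDiffAt_sqrt hr.ne').inv (Real.sqrt_pos.2 hr).ne'
  · dsimp only
    rw [Real.smoothTransition.one_of_one_le (by linarith), one_mul]

lemma norm_toLp_eq_one_iff (x : Fin 3 → ℝ) : ‖WithLp.toLp 2 x‖ = 1 ↔ x ⬝ᵥ x = 1 := by
  rw [EuclideanSpace.norm_eq, Real.sqrt_eq_one]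
  simp [dotProduct, sq]

lemma eqOn_of_hasTrace {u g : ℝ → Fin 3 → ℝ} {p : ℝ} {c : Fin 3 → ℝ} (h : HasTrace u p c)
    (hg : Continuous g) (hug : u =ᵐ[volume.restrict I] g) (hp : p ∈ Set.Icc (0 : ℝ) 1) :
    g p = c := by
  obtain ⟨k, hk, huk, rfl⟩ := h
  refine Measure.eqOn_Icc_of_ae_eq volume zero_ne_one ?_ hg.continuousOn hk hp
  rw [← restrict_Ioo_eq_restrict_Icc]
  exact hug.symm.trans huk

/-- The boundary value at the endpoint `p`: `a` at `0` and `e₃` at `1` (and at all other points,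
where it is not used). -/
noncomputable def boundaryValue (a : Fin 3 → ℝ) (p : ℝ) : Fin 3 → ℝ := if p = 0 then a else e₃

lemma boundaryValue_dot_self {a : Fin 3 → ℝ} (ha : a ⬝ᵥ a = 1) (p : ℝ) :
    boundaryValue a p ⬝ᵥ boundaryValue a p = 1 := by
  unfold boundaryValue
  split_ifs
  · exact ha
  · simp [e₃, dotProduct, Fin.sum_univ_three]

/-- A smooth curve with the right boundary values which is symmetric near the endpoints satisfies
all compatibility conditions. -/
lemma compat_of_symmetric {a : Fin 3 → ℝ} (ha : a ⬝ᵥ a = 1) {v : ℝ → Fin 3 → ℝ}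
    (hv : ContDiff ℝ ∞ v) (hb : ∀ p : ℝ, p = 0 ∨ p = 1 → v p = boundaryValue a p ∧
      ∀ᶠ s in 𝓝 p, v (2 * p - s) = halfTurn (boundaryValue a p) (v s)) (m : ℕ) :
    Compat a m v := by
  refine ⟨memHVec_of_contDiff hv _, fun _ => ⟨⟨v, hv.continuous.continuousOn, ae_eq_refl _, ?_⟩,
    ⟨v, hv.continuous.continuousOn, ae_eq_refl _, ?_⟩⟩, fun hm => ?_⟩
  · simpa [boundaryValue] using (hb 0 (Or.inl rfl)).1
  · simpa [boundaryValue] using (hb 1 (Or.inr rfl)).1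
  · have h1 := P_ae_eq_classicalP (ae_eq_refl v) m (contDiff_infty.1 hv _)
    have h2 := (contDiff_classicalP_infty hv m).continuous.continuousOn (s := Set.Icc 0 1)
    exact ⟨⟨_, h2, h1, classicalP_eq_zero_of_symmetric (boundaryValue_dot_self ha _) hv
      (hb 0 (Or.inl rfl)).2 hm⟩, ⟨_, h2, h1, classicalP_eq_zero_of_symmetric
      (boundaryValue_dot_self ha _) hv (hb 1 (Or.inr rfl)).2 hm⟩⟩

end Compatibility

/-! ### Approximation of compatible data -/

section Main

lemma SobolevTendsto.comp_add {E : Type*} [NormedAddCommGroup E] [NormedSpace ℝ E] (k : ℕ) {m : ℕ} :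
    ∀ {u : ℕ → ℝ → E} {g : ℝ → E}, SobolevTendsto m u g →
      SobolevTendsto m (fun n => u (n + k)) g := by
  induction m with
  | zero => exact fun h => ⟨h.1, h.2.comp (tendsto_add_atTop_nat k)⟩
  | succ m ih =>
    rintro u g ⟨h0, h, hh, hg⟩
    exact ⟨h0.comp (tendsto_add_atTop_nat k), h, ih hh, hg⟩

/-- A datum satisfying the compatibility conditions up to order `K` has a representative of class
`C^{2K}` whose derivatives at the endpoints are those of symmetric curves. -/
lemma exists_representative {K : ℕ} {a : Fin 3 → ℝ} (ha : a ⬝ᵥ a = 1) {v₀ : ℝ → Fin 3 → ℝ}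
    (hunit : UnitLength v₀) (hcompat : CompatUpTo a K v₀) :
    ∃ g, v₀ =ᵐ[volume.restrict I] g ∧ SobolevRep (2 * K + 1) g ∧
      (∀ s ∈ Set.Icc (0 : ℝ) 1, g s ⬝ᵥ g s = 1) ∧
      ∀ p : ℝ, p = 0 ∨ p = 1 → g p = boundaryValue a p ∧ ∀ j < 2 * K + 1,
        iteratedDeriv j g p =
          (-1 : ℝ) ^ j • halfTurn (boundaryValue a p) (iteratedDeriv j g p) := by
  obtain ⟨g, hvg, hg⟩ := (hcompat K le_rfl).1.exists_sobolevRep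
  have hgs : ContDiff ℝ (2 * K : ℕ) g := SobolevRep.regularity.2 hg
  have hg1 : ∀ s ∈ Set.Icc (0 : ℝ) 1, g s ⬝ᵥ g s = 1 := by
    refine Measure.eqOn_Icc_of_ae_eq (f := fun s => g s ⬝ᵥ g s) (g := fun _ => (1 : ℝ)) volume
      zero_ne_one ?_ (contDiff_bilinear dotL hgs hgs).continuous.continuousOn continuousOn_const
    rw [← restrict_Ioo_eq_restrict_Icc]
    filter_upwards [hvg, hunit] with s h1 h2
    rw [← h1]
    exact (norm_toLp_eq_one_iff _).1 h2
  refine ⟨g, hvg, hg, hg1, fun p hp => ?_⟩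
  have hpI : p ∈ Set.Icc (0 : ℝ) 1 := by rcases hp with rfl | rfl <;> simp
  have hgp : g p = boundaryValue a p := by
    obtain ⟨h0, h1⟩ := (hcompat 0 (Nat.zero_le _)).2.1 rfl
    rcases hp with rfl | rfl
    · simpa [boundaryValue] using eqOn_of_hasTrace h0 hgs.continuous hvg hpI
    · simpa [boundaryValue] using eqOn_of_hasTrace h1 hgs.continuous hvg hpI
  refine ⟨hgp, fun j hj => ?_⟩
  refine iteratedDeriv_eq_halfTurn (boundaryValue_dot_self ha p) hgs hg1 hpI hgp
    (fun m hm hmK => ?_) j (by omega)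
  have hgm : ContDiff ℝ (0 + 2 * m : ℕ) g := hgs.of_le (by exact_mod_cast (by omega))
  have hc : Continuous (classicalP g m) := (contDiff_classicalP m hgm).continuous
  have hae := P_ae_eq_classicalP hvg m (by simpa using hgm)
  obtain ⟨h0, h1⟩ := (hcompat m hmK).2.2 hm
  rcases hp with rfl | rfl
  · exact eqOn_of_hasTrace h0 hc hae hpI
  · exact eqOn_of_hasTrace h1 hc hae hpI

/-- A datum satisfying the compatibility conditions up to order `K` is a limit in `H^{2K+1}(I)` of
smooth data satisfying all compatibility conditions. -/
theorem exists_smooth_compatible_approximation {K : ℕ} {a : Fin 3 → ℝ} (ha : a ⬝ᵥ a = 1)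
    {v₀ : ℝ → Fin 3 → ℝ} (hunit : UnitLength v₀) (hcompat : CompatUpTo a K v₀) :
    ∃ (v : ℕ → ℝ → Fin 3 → ℝ) (g : ℝ → Fin 3 → ℝ), v₀ =ᵐ[volume.restrict I] g ∧
      (∀ n, ContDiff ℝ ∞ (v n)) ∧ (∀ n, ∀ s ∈ Set.Icc (0 : ℝ) 1, v n s ⬝ᵥ v n s = 1) ∧
      (∀ n m, Compat a m (v n)) ∧ SobolevTendsto (2 * K + 1) v g := by
  obtain ⟨g, hvg, hg, hg1, hb⟩ := exists_representative ha hunit hcompat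
  obtain ⟨w, hw, hwg, hws⟩ := exists_symmetric_sobolevTendsto
    (R := fun p => halfTurn (boundaryValue a p)) hg fun p hp => (hb p hp).2
  obtain ⟨φ, hφ, hφ1⟩ := exists_smooth_inv_sqrt
  have hq : ∀ n, ContDiff ℝ ∞ (fun s => dotL (w n s) (w n s)) := fun n =>
    contDiff_bilinear dotL (hw n) (hw n)
  have hqg := SobolevTendsto.bilinear dotL hw hw hwg hwg
  have hqu := (SobolevTendsto.continuousOn_and_uniform_and_mono hq hqg).2.1
  -- from some index on, `|w n|² ≥ 1/4` on `[0,1]`, so that `φ (|w n|²) w n` is `w n / |w n|`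
  obtain ⟨n₀, hn₀⟩ : ∃ n₀, ∀ n, n₀ ≤ n → ∀ s ∈ Set.Icc (0 : ℝ) 1, 1 / 4 ≤ dotL (w n s) (w n s) := by
    rw [← eventually_atTop]
    filter_upwards [Metric.tendstoUniformlyOn_iff.1 hqu (3 / 4) (by norm_num)] with n hn s hs
    have h1 := hn s hs
    rw [dotL_apply (g s), hg1 s hs, Real.dist_eq] at h1
    linarith [(abs_lt.1 h1).2]
  have hv : ∀ n, ContDiff ℝ ∞ (fun s => φ (dotL (w n s) (w n s)) • w n s) := fun n =>
    (hφ.comp (hq n)).smul (hw n)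
  have hlim : SobolevTendsto (2 * K + 1) (fun n s => φ (dotL (w n s) (w n s)) • w n s)
      (fun s => φ (dotL (g s) (g s)) • g s) :=
    SobolevTendsto.bilinear (ContinuousLinearMap.lsmul ℝ ℝ) (fun n => hφ.comp (hq n)) hw
      (SobolevTendsto.comp hq hφ hqg) hwg
  have hφ₁ : φ 1 = 1 := by rw [hφ1 1 (by norm_num)]; simp
  refine ⟨fun n s => φ (dotL (w (n + n₀) s) (w (n + n₀) s)) • w (n + n₀) s, _, ?_,
    fun n => hv _, fun n s hs => ?_,
    fun n m => compat_of_symmetric ha (hv _) (fun p hp => ⟨?_, ?_⟩) m, hlim.comp_add n₀⟩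
  · filter_upwards [hvg, ae_restrict_mem measurableSet_Ioo] with s h1 h2
    rw [dotL_apply, hg1 s (Set.Ioo_subset_Icc_self h2), hφ₁, one_smul, h1]
  · have h1 := hn₀ (n + n₀) (Nat.le_add_left _ _) s hs
    have h2 : 0 < dotL (w (n + n₀) s) (w (n + n₀) s) := by linarith
    dsimp only
    rw [hφ1 _ h1, smul_dotProduct, dotProduct_smul, ← dotL_apply, smul_eq_mul, smul_eq_mul]
    have h3 := Real.mul_self_sqrt h2.le
    have h4 := (Real.sqrt_pos.2 h2).ne'
    field_simp
    rw [sq, h3]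
  · rw [(hws p hp (n + n₀)).2 (Nat.succ_pos _), (hb p hp).1, dotL_apply,
      boundaryValue_dot_self ha, hφ₁, one_smul]
  · filter_upwards [(hws p hp (n + n₀)).1] with s hs
    rw [hs, dotL_apply, halfTurn_dot (boundaryValue_dot_self ha p), map_smul, dotL_apply]

end Main
end VortexFilament

theorem mainTheorem4 (l N : ℕ) (a : Fin 3 → ℝ) (ha : ‖WithLp.toLp 2 a‖ = 1)
    (v₀ : ℝ → Fin 3 → ℝ)
    (hv₀ : VortexFilament.MemHVec (l + 3) v₀)
    (hunit : VortexFilament.UnitLength v₀)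
    (hcompat : VortexFilament.CompatUpTo a ((l + 3) / 2) v₀) :
    ∃ v : ℕ → ℝ → Fin 3 → ℝ,
      (∀ n, VortexFilament.UnitLength (v n) ∧
        VortexFilament.MemHVec (l + 3 + N) (v n) ∧
        VortexFilament.CompatUpTo a ((l + 3 + N) / 2) (v n)) ∧
      Tendsto (fun n => VortexFilament.normH (l + 3) (fun s => v n s - v₀ s)) atTop (𝓝 0) := by
  obtain ⟨v, g, hvg, hv, hv1, hvc, hlim⟩ := VortexFilament.exists_smooth_compatible_approximation
    ((VortexFilament.norm_toLp_eq_one_iff a).1 ha) hunit hcompat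
  refine ⟨v, fun n => ⟨?_, VortexFilament.memHVec_of_contDiff (hv n) _, fun m _ => hvc n m⟩,
    hlim.tendsto_normH (by omega) hv hvg⟩
  filter_upwards [ae_restrict_mem measurableSet_Ioo] with s hs
  exact (VortexFilament.norm_toLp_eq_one_iff _).2 (hv1 n s (Set.Ioo_subset_Icc_self hs))
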